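/- Let $G=(V,E)$ be a finite simple undirected graph with positive edge weights $w:E\to\mathbb{R}_{>0}$; write $w(F)=\sum_{e\in F}w(e)$ for $F\subseteq E$. Two edges are adjacent if they have a vertex in common; a matching is a set of pairwise non-adjacent edges. For $M,F\subseteq E$ let $M(F)$ be the set of edges of $M$ adjacent to an edge of $F$. Let $k>1$. The algorithm Shadow Matching$(G,k)$ reads the edges of $G$ once each, in an arbitrary order, in a single pass. It maintains a set $M$ of edges, initially empty, and for an edge $e\in M$ and an endpoint $a$ of $e$ at most one stored edge shadow-edge$(e,a)$ containing $a$; initially none is stored. On reading an input edge $y_1y_2$ it does the following. 1. For $i=1,2$ let $g_iy_i$ be the edge of $M$ covering $y_i$, let $a_ig_i$ be shadow-edge$(g_iy_i,g_i)$, and let $a_ic_i$ be the edge of $M$ covering $a_i$; edges that do not exist are omitted. Let $S$ be the set of the existing edges among $y_1y_2,g_1y_1,a_1g_1,a_1c_1,g_2y_2,a_2g_2,a_2c_2$. 2. Among all sets $A\subseteq S\setminus M$ of pairwise non-adjacent edges (the empty set included) choose one that maximizes $r(A)=w(A)-k\,w(M(A))$, breaking ties arbitrarily. 3. If $r(A)>0$,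 replace $M$ by $(M\setminus M(A))\cup A$. Each removed edge $f\in M(A)$ is stored as shadow-edge$(e,a)$ for every $e\in A$ that shares a vertex $a$ with $f$; edges that stay in $M$ keep their shadow-edges, and the shadow-edges of removed edges are forgotten. If $r(A)\le 0$, nothing changes. The output is the final $M$. **Theorem.** For every $k>1$, every order of the edges and every way of breaking ties, the algorithm can be carried out, its output $M$ is a matching of $G$, and for every maximum-weight matching $M^*$ of $G$ $$w(M^*)\le\left(k+\frac{k}{k-1}+\frac{k^3-k+1}{k^2}\right)w(M).$$ On $(1,\infty)$ the factor attains its minimum at some $k_0$ with $|k_0-1.717|<0.0005$, and the values of the factor at $k_0$ and at $1.717$ both differ from $5.585$ by less than $0.0005$. In particular, for $k=1.717$ one has $w(M^*)\le 5.5855\,w(M)$. -/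

import Mathlib

namespace ShadowMatching

/-- Two edges are adjacent if they have a vertex in common. -/
def Adjacent {V : Type*} (e f : Sym2 V) : Prop := ∃ v, v ∈ e ∧ v ∈ f

/-- No two distinct edges of `F` have a vertex in common. -/
def PairwiseNonadjacent {V : Type*} (F : Finset (Sym2 V)) : Prop :=
  ∀ e ∈ F, ∀ f ∈ F, e ≠ f → ¬ Adjacent e f

/-- A matching of `G`, given as a finite set of edges. -/
def IsMatching {V : Type*} (G : SimpleGraph V) (M : Finset (Sym2 V)) : Prop :=
  (∀ e ∈ M, e ∈ G.edgeSet) ∧ PairwiseNonadjacent M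

/-- The weight of a set of edges. -/
def weight {V : Type*} (w : Sym2 V → ℝ) (F : Finset (Sym2 V)) : ℝ := ∑ e ∈ F, w e

/-- A matching of `G` whose weight is maximum over all matchings of `G`. -/
def IsMaxWeightMatching {V : Type*} (G : SimpleGraph V) (w : Sym2 V → ℝ)
    (M : Finset (Sym2 V)) : Prop :=
  IsMatching G M ∧ ∀ N, IsMatching G N → weight w N ≤ weight w M

/-- An edge stream that presents every edge of `G` exactly once, in arbitrary order. -/
def IsEdgeStream {V : Type*} (G : SimpleGraph V) (L : List (Sym2 V)) : Prop :=
  L.Nodup ∧ ∀ e, e ∈ L ↔ e ∈ G.edgeSet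

open Classical in
/-- `M(F)`: the edges of `M` that are adjacent to an edge of `F`. -/
noncomputable def touching {V : Type*} (M F : Finset (Sym2 V)) : Finset (Sym2 V) :=
  M.filter fun e => ∃ f ∈ F, Adjacent e f

/-- What the algorithm stores: the current set `M`, and the shadow-edges, where `Shadow e a s`
says that `s` is stored as shadow-edge`(e, a)`. Missing shadow-edges ("null-edges") are
represented by the absence of such an `s`. -/
@[ext]
structure State (V : Type*) where
  M : Finset (Sym2 V)
  Shadow : Sym2 V → V → Sym2 V → Prop

/-- Initially `M` is empty and no shadow-edge is stored. -/
def State.init (V : Type*) : State V where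
  M := ∅
  Shadow := fun _ _ _ => False

/-- The set `S` of the edges tagged for the input edge `y`: the edge `y` itself; for each endpoint
`v` of `y` the edge `gv` of `M` covering `v`; the shadow-edge `ag` of `gv` at `g`;
and the edge of `M` covering `a`. -/
def State.tagged {V : Type*} (σ : State V) (y : Sym2 V) : Set (Sym2 V) :=
  {e | e = y
    ∨ (∃ v ∈ y, e ∈ σ.M ∧ v ∈ e)
    ∨ (∃ v ∈ y, ∃ g, s(g, v) ∈ σ.M ∧ σ.Shadow s(g, v) g e)
    ∨ (∃ v ∈ y, ∃ g a, s(g, v) ∈ σ.M ∧ σ.Shadow s(g, v) g s(a, g) ∧ e ∈ σ.M ∧ a ∈ e)}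

/-- `A` is an augmenting set contained in `S`: its edges are tagged, are not in `M`, and are
pairwise not adjacent. The empty set is allowed. -/
def State.IsAugmenting {V : Type*} (σ : State V) (y : Sym2 V) (A : Finset (Sym2 V)) : Prop :=
  (∀ e ∈ A, e ∈ σ.tagged y) ∧ (∀ e ∈ A, e ∉ σ.M) ∧ PairwiseNonadjacent A

/-- `r(A) = w(A) - k w(M(A))`. -/
noncomputable def State.gain {V : Type*} (k : ℝ) (w : Sym2 V → ℝ) (σ : State V)
    (A : Finset (Sym2 V)) : ℝ :=
  weight w A - k * weight w (touching σ.M A)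

open Classical in
/-- Insertion of `A` into `M`: the edges of `M(A)` leave `M` and each of them is stored as a
shadow-edge of every edge of `A` adjacent to it, at the common vertex. Edges that stay in `M` keep
their shadow-edges, and the shadow-edges of edges leaving `M` are forgotten. -/
noncomputable def State.insert {V : Type*} (σ : State V) (A : Finset (Sym2 V)) : State V where
  M := (σ.M \ touching σ.M A) ∪ A
  Shadow := fun e a s =>
    (e ∈ σ.M \ touching σ.M A ∧ σ.Shadow e a s)
      ∨ (e ∈ A ∧ s ∈ touching σ.M A ∧ a ∈ e ∧ a ∈ s)

/-- One iteration of the loop on the input edge `y` can lead from `σ` to `τ`. Here `A` is any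
augmenting set maximizing `r`; ties may be broken arbitrarily. -/
def Step {V : Type*} (k : ℝ) (w : Sym2 V → ℝ) (σ : State V) (y : Sym2 V) (τ : State V) : Prop :=
  ∃ A, σ.IsAugmenting y A ∧ (∀ B, σ.IsAugmenting y B → σ.gain k w B ≤ σ.gain k w A) ∧
    τ = if 0 < σ.gain k w A then σ.insert A else σ

/-- `Run k w L σ`: after a single pass over the edge stream `L`, the algorithm with parameter `k`
can be in state `σ`. -/
inductive Run {V : Type*} (k : ℝ) (w : Sym2 V → ℝ) : List (Sym2 V) → State V → Prop
  | nil : Run k w [] (State.init V)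
  | snoc {L : List (Sym2 V)} {σ τ : State V} {y : Sym2 V} :
      Run k w L σ → Step k w σ y τ → Run k w (L ++ [y]) τ

/-- The approximation factor as a function of `k`. -/
noncomputable def ratio (k : ℝ) : ℝ := k + k / (k - 1) + (k ^ 3 - k + 1) / k ^ 2

end ShadowMatching

namespace ShadowMatching

open Classical

/-! The proof is an amortized accounting. Fix a matching `N` to compare with; at each moment let O
be the weight of its edges read so far and X the set of their endpoints. Write θ = 1 - 1/k and let d
be the total weight ever removed from `M`. Up to corrections, O is bounded by (k - θ²)d plus k times
the weight of the `M`-edge at v for each v in X. Inserted sets have nonnegative gain, so (k-1)d ≤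
w(M); an edge has two endpoints, so the factor is 2k + (k - θ²)/(k-1), which is `ratio k`
(`ratio_eq`).

An insertion must preserve this bound (`Ledger.insert`). Maximality of the inserted set A gives a
Hall condition, so the weight of the removed edges can be shared among the endpoints of A, an edge e
of A receiving at most w(e)/k (`exists_insert_shares`). The shares say how much each inserted edge
must take over from the removed ones.

Charging only k - θ² per removed unit leaves a gap when xz is replaced by xy with z in X but x and y
not: no endpoint of xy may contribute yet. Then y takes a loan of θ times the share at x, and z is
pledged for it: while the pledge lasts, z counts with the coefficient θ/k instead of k. The
algorithm keeps xz as the shadow-edge of xy at x, so the pledge remains visible to it.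

When an optimal edge at y is read, the loan must be repaid (`Ledger.read`). If A covers an endpoint
of the input edge, the inserted edges there suffice (`weight_le_of_covered`). Otherwise the
algorithm could have taken the input edge, alone or with the shadow-edges behind the pledges. Since
it preferred A, the combination with weights 1-θ and θ of these two comparisons bounds the weight of
the input edge plus the loans by what its endpoints and the released vertices z contribute
(`Ledger.contribution`). -/

/-- The weight of the edges of `F` that contain `v`; for a matching, the weight of the edge
covering `v`, or zero. -/
noncomputable def cov {V : Type*} (w : Sym2 V → ℝ) (F : Finset (Sym2 V)) (v : V) : ℝ :=
  ∑ e ∈ F with v ∈ e, w e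

/-! ### Matchings, covering weights and sums over vertices -/

section Basic

variable {V : Type*} {w : Sym2 V → ℝ} {F : Finset (Sym2 V)}

lemma PairwiseNonadjacent.eq_of_mem (hF : PairwiseNonadjacent F) {e f : Sym2 V} (he : e ∈ F)
    (hf : f ∈ F) {v : V} (hve : v ∈ e) (hvf : v ∈ f) : e = f := by
  by_contra h
  exact hF e he f hf h ⟨v, hve, hvf⟩

lemma PairwiseNonadjacent.right_unique (hF : PairwiseNonadjacent F) {x y z : V}
    (hy : s(x, y) ∈ F) (hz : s(x, z) ∈ F) : y = z := by
  have := hF.eq_of_mem hy hz (Sym2.mem_mk_left x y) (Sym2.mem_mk_left x z)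
  exact Sym2.congr_right.1 this

lemma PairwiseNonadjacent.left_unique (hF : PairwiseNonadjacent F) {x y z : V}
    (hx : s(x, z) ∈ F) (hy : s(y, z) ∈ F) : x = y := by
  have := hF.eq_of_mem hx hy (Sym2.mem_mk_right x z) (Sym2.mem_mk_right y z)
  exact Sym2.congr_left.1 this

lemma PairwiseNonadjacent.subset {F' : Finset (Sym2 V)} (hF : PairwiseNonadjacent F)
    (h : F' ⊆ F) : PairwiseNonadjacent F' :=
  fun e he f hf => hF e (h he) f (h hf)

lemma exists_mk_of_mem {e : Sym2 V} {v : V} (h : v ∈ e) : ∃ x, e = s(x, v) := by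
  obtain ⟨x, rfl⟩ := Sym2.mem_iff_exists.1 h
  exact ⟨x, Sym2.eq_swap⟩

lemma cov_eq (hF : PairwiseNonadjacent F) {e : Sym2 V} (he : e ∈ F) {v : V} (hv : v ∈ e) :
    cov w F v = w e := by
  have : F.filter (fun f => v ∈ f) = {e} := by
    ext f
    simp only [Finset.mem_filter, Finset.mem_singleton]
    constructor
    · rintro ⟨hf, hvf⟩
      exact hF.eq_of_mem hf he hvf hv
    · rintro rfl
      exact ⟨he, hv⟩
  rw [cov, this, Finset.sum_singleton]

lemma cov_eq_zero {v : V} (h : ∀ e ∈ F, v ∉ e) : cov w F v = 0 := by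
  rw [cov, Finset.filter_false_of_mem h, Finset.sum_empty]

lemma cov_nonneg (hw : ∀ e ∈ F, 0 ≤ w e) (v : V) : 0 ≤ cov w F v :=
  Finset.sum_nonneg fun e he => hw e (Finset.mem_filter.1 he).1

lemma cov_union {F' : Finset (Sym2 V)} (h : Disjoint F F') (v : V) :
    cov w (F ∪ F') v = cov w F v + cov w F' v := by
  rw [cov, Finset.filter_union, Finset.sum_union]
  · rfl
  · exact Finset.disjoint_filter_filter h

lemma sum_mem_mk [Fintype V] (g : V → ℝ) {x y : V} (h : x ≠ y) :
    ∑ v with v ∈ s(x, y), g v = g x + g y := by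
  have : (Finset.univ.filter fun v => v ∈ s(x, y)) = {x, y} := by
    ext v
    simp
  rw [this, Finset.sum_pair h]

/-- A sum over the vertices covered by a matching, taken edge by edge. -/
lemma sum_eq_sum_edges [Fintype V] (hF : PairwiseNonadjacent F) {g : V → ℝ}
    (hg : ∀ v, (∀ e ∈ F, v ∉ e) → g v = 0) :
    ∑ v, g v = ∑ e ∈ F, ∑ v with v ∈ e, g v := by
  have h1 : ∀ e ∈ F, ∑ v with v ∈ e, g v = ∑ v, if v ∈ e then g v else 0 := fun e _ => by
    rw [Finset.sum_filter]
  rw [Finset.sum_congr rfl h1, Finset.sum_comm]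
  refine Finset.sum_congr rfl fun v _ => ?_
  by_cases h : ∀ e ∈ F, v ∉ e
  · rw [hg v h]
    simp
  · push Not at h
    obtain ⟨e, he, hv⟩ := h
    rw [Finset.sum_eq_single e]
    · simp [hv]
    · intro f hf hne
      rw [if_neg]
      intro hvf
      exact hne (hF.eq_of_mem hf he hvf hv)
    · exact fun h => absurd he h

lemma sum_le_sum_edges [Fintype V] (hF : PairwiseNonadjacent F) (hd : ∀ e ∈ F, ¬ e.IsDiag)
    {g : V → ℝ} (hg : ∀ v, (∀ e ∈ F, v ∉ e) → g v = 0) {b : Sym2 V → ℝ}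
    (hb : ∀ x y, s(x, y) ∈ F → g x + g y ≤ b s(x, y)) : ∑ v, g v ≤ ∑ e ∈ F, b e := by
  rw [sum_eq_sum_edges hF hg]
  refine Finset.sum_le_sum fun e he => ?_
  induction e with
  | h x y =>
    rw [sum_mem_mk g (by simpa using hd _ he)]
    exact hb x y he

lemma sum_cov [Fintype V] (hF : PairwiseNonadjacent F) (hd : ∀ e ∈ F, ¬ e.IsDiag) :
    ∑ v, cov w F v = 2 * weight w F := by
  rw [sum_eq_sum_edges hF fun v hv => cov_eq_zero hv, weight, Finset.mul_sum]
  refine Finset.sum_congr rfl fun e he => ?_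
  induction e with
  | h x y =>
    rw [sum_mem_mk _ (by simpa using hd _ he), cov_eq hF he (Sym2.mem_mk_left x y),
      cov_eq hF he (Sym2.mem_mk_right x y)]
    ring

lemma weight_union {F' : Finset (Sym2 V)} (h : Disjoint F F') :
    weight w (F ∪ F') = weight w F + weight w F' := Finset.sum_union h

lemma weight_sdiff {F' : Finset (Sym2 V)} (h : F' ⊆ F) :
    weight w (F \ F') = weight w F - weight w F' := by
  have := Finset.sum_sdiff (f := w) h
  simp only [weight]
  linarith

lemma weight_mono {F' : Finset (Sym2 V)} (h : F' ⊆ F) (hw : ∀ e ∈ F, 0 ≤ w e) :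
    weight w F' ≤ weight w F :=
  Finset.sum_le_sum_of_subset_of_nonneg h fun e he _ => hw e he

lemma weight_union_le {F' : Finset (Sym2 V)} (hw : ∀ e ∈ F, 0 ≤ w e) :
    weight w (F ∪ F') ≤ weight w F + weight w F' := by
  have h := Finset.sum_union_inter (s₁ := F) (s₂ := F') (f := w)
  have : 0 ≤ ∑ e ∈ F ∩ F', w e :=
    Finset.sum_nonneg fun e he => hw e (Finset.mem_inter.1 he).1
  simp only [weight]
  linarith

lemma mem_touching {M A : Finset (Sym2 V)} {e : Sym2 V} :
    e ∈ touching M A ↔ e ∈ M ∧ ∃ f ∈ A, Adjacent e f := by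
  simp [touching]

lemma touching_subset (M A : Finset (Sym2 V)) : touching M A ⊆ M := Finset.filter_subset _ _

lemma mem_touching_of_mem {M A : Finset (Sym2 V)} {e f : Sym2 V} (he : e ∈ M) (hf : f ∈ A)
    {v : V} (hve : v ∈ e) (hvf : v ∈ f) : e ∈ touching M A :=
  mem_touching.2 ⟨he, f, hf, v, hve, hvf⟩

end Basic

/-! ### Fractional Hall theorem for two matchings -/

section Shares

variable {V : Type*} {w : Sym2 V → ℝ}

/-- The edges of `K` all of whose neighbours in `A` belong to `C`. -/
noncomputable def absorbed (K A C : Finset (Sym2 V)) : Finset (Sym2 V) :=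
  K.filter fun f => ∀ e ∈ A, Adjacent f e → e ∈ C

lemma sum_ite_mem {A C : Finset (Sym2 V)} (hA : PairwiseNonadjacent A) (hC : C ⊆ A) (x : V)
    (t : ℝ) : ∑ e ∈ C, (if x ∈ e then t else 0) = if ∃ e ∈ C, x ∈ e then t else 0 := by
  split_ifs with h
  · obtain ⟨e, he, hx⟩ := h
    rw [Finset.sum_eq_single e]
    · simp [hx]
    · intro f hf hne
      rw [if_neg]
      exact fun hxf => hne (hA.eq_of_mem (hC hf) (hC he) hxf hx)
    · exact fun h => absurd he h
  · refine Finset.sum_eq_zero fun e he => if_neg fun hx => h ⟨e, he, hx⟩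

/-- The minimum of `p` on `S` serves as `t` when some value there is below `u`; otherwise `u` itself
does. In the application `S` and `T` index the Hall constraints on the two shares of one edge. -/
lemma exists_split {ι : Type*} (S T : Finset ι) (p : ι → ℝ) {u : ℝ} (hu : 0 ≤ u)
    (hS : ∀ i ∈ S, 0 ≤ p i) (hT : ∀ i ∈ T, 0 ≤ p i)
    (h : ∀ i ∈ S, ∀ j ∈ T, u ≤ p i + p j) :
    ∃ t, 0 ≤ t ∧ t ≤ u ∧ (∀ i ∈ S, t ≤ p i) ∧ ∀ j ∈ T, u - t ≤ p j := by
  by_cases hall : ∀ i ∈ S, u ≤ p i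
  · exact ⟨u, hu, le_rfl, hall, fun j hj => by simpa using hT j hj⟩
  · push Not at hall
    obtain ⟨i₀, hi₀, hlt⟩ := hall
    obtain ⟨i, hi, hmin⟩ := Finset.exists_min_image S p ⟨i₀, hi₀⟩
    refine ⟨p i, hS i hi, ?_, hmin, fun j hj => ?_⟩
    · linarith [hmin i₀ hi₀]
    · linarith [h i hi j hj]

/-- Fractional Hall theorem for two matchings: the weights of the edges of `K` can be shared among
adjacent edges of `A` within the capacities `c`. -/
theorem exists_shares {A : Finset (Sym2 V)} (hA : PairwiseNonadjacent A)
    (hAd : ∀ e ∈ A, ¬ e.IsDiag) (K : Finset (Sym2 V)) (hK : PairwiseNonadjacent K)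
    (hKd : ∀ e ∈ K, ¬ e.IsDiag) (hw : ∀ e ∈ K, 0 ≤ w e) (c : Sym2 V → ℝ)
    (hall : ∀ C ⊆ A, weight w (absorbed K A C) ≤ ∑ e ∈ C, c e) :
    ∃ α : V → ℝ, (∀ v, 0 ≤ α v) ∧ (∀ v, (∀ e ∈ A, v ∉ e) → α v = 0) ∧
      (∀ v, (∀ f ∈ K, v ∉ f) → α v = 0) ∧
      (∀ x z, s(x, z) ∈ K → α x + α z = w s(x, z)) ∧
      ∀ x y, s(x, y) ∈ A → α x + α y ≤ c s(x, y) := by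
  induction K using Finset.induction_on generalizing c with
  | empty =>
    refine ⟨fun _ => 0, by simp, by simp, by simp, by simp, fun x y h => ?_⟩
    simpa [weight, absorbed] using hall {s(x, y)} (by simpa using h)
  | insert f K hfK ih =>
    induction f with
    | h x z =>
    have hxz : x ≠ z := by simpa using hKd _ (Finset.mem_insert_self _ _)
    set u := w s(x, z) with hu
    have hu0 : 0 ≤ u := hw _ (Finset.mem_insert_self _ _)
    have hw' : ∀ e ∈ K, 0 ≤ w e := fun e he => hw e (Finset.mem_insert_of_mem he)
    have hxK : ∀ f ∈ K, x ∉ f := fun f hf hx => hfK <| by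
      rwa [hK.eq_of_mem (Finset.mem_insert_self _ _) (Finset.mem_insert_of_mem hf)
        (Sym2.mem_mk_left x z) hx]
    have hzK : ∀ f ∈ K, z ∉ f := fun f hf hx => hfK <| by
      rwa [hK.eq_of_mem (Finset.mem_insert_self _ _) (Finset.mem_insert_of_mem hf)
        (Sym2.mem_mk_right x z) hx]
    have habs : ∀ C, absorbed K A C ⊆ absorbed (insert s(x, z) K) A C := fun C =>
      Finset.filter_subset_filter _ (Finset.subset_insert _ _)
    have hwabs : ∀ C, ∀ e ∈ absorbed (insert s(x, z) K) A C, 0 ≤ w e := fun C e he =>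
      hw e (Finset.mem_filter.1 he).1
    have hall' : ∀ C ⊆ A, weight w (absorbed K A C) ≤ ∑ e ∈ C, c e := fun C hC =>
      (weight_mono (habs C) (hwabs C)).trans (hall C hC)
    have hfull : ∀ C ⊆ A, (∀ e ∈ A, x ∈ e → e ∈ C) → (∀ e ∈ A, z ∈ e → e ∈ C) →
        weight w (absorbed K A C) + u ≤ ∑ e ∈ C, c e := by
      intro C hC hx hz
      refine le_trans (le_of_eq ?_) (hall C hC)
      have : absorbed (insert s(x, z) K) A C = insert s(x, z) (absorbed K A C) := by
        rw [absorbed, Finset.filter_insert, if_pos]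
        · rfl
        · rintro e he ⟨v, hv, hve⟩
          rcases Sym2.mem_iff.1 hv with rfl | rfl
          · exact hx e he hve
          · exact hz e he hve
      rw [this, weight, weight, Finset.sum_insert]
      · ring
      · exact fun h => hfK (Finset.mem_filter.1 h).1
    -- the split of the weight of `s(x, z)` between its two endpoints
    have hsplit : ∃ t s : ℝ, 0 ≤ t ∧ 0 ≤ s ∧ t + s = u ∧
        ((∀ e ∈ A, x ∉ e) → t = 0) ∧ ((∀ e ∈ A, z ∉ e) → s = 0) ∧
        ∀ C ⊆ A, weight w (absorbed K A C) ≤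
          ∑ e ∈ C, c e - (if ∃ e ∈ C, x ∈ e then t else 0) -
            (if ∃ e ∈ C, z ∈ e then s else 0) := by
      by_cases hx : ∃ e ∈ A, x ∈ e
      · obtain ⟨e₁, he₁, hxe₁⟩ := hx
        have hx' : ∀ e ∈ A, x ∈ e → e = e₁ := fun e he hxe => hA.eq_of_mem he he₁ hxe hxe₁
        by_cases hz : ∃ e ∈ A, z ∈ e
        · obtain ⟨e₂, he₂, hze₂⟩ := hz
          have hz' : ∀ e ∈ A, z ∈ e → e = e₂ := fun e he hxe => hA.eq_of_mem he he₂ hxe hze₂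
          -- Here `p` is the slack in Hall's condition. Sets containing only `e₁` constrain the
          -- share at x, sets containing only `e₂` the share at z. The weight of `absorbed` is
          -- supermodular in `C`, so two such slacks add up to at least `u`: the union absorbs `s(x,
          -- z)` as well. If `e₁ = e₂`, both families are empty.
          obtain ⟨t, ht0, htu, hS, hT⟩ := exists_split
            (A.powerset.filter fun C => e₁ ∈ C ∧ e₂ ∉ C)
            (A.powerset.filter fun C => e₂ ∈ C ∧ e₁ ∉ C)
            (fun C => ∑ e ∈ C, c e - weight w (absorbed K A C)) hu0
            (fun C hC => sub_nonneg.2 (hall' C (by simp_all)))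
            (fun C hC => sub_nonneg.2 (hall' C (by simp_all))) (by
              intro C hC C' hC'
              simp only [Finset.mem_filter, Finset.mem_powerset] at hC hC'
              have h1 := hfull (C ∪ C') (Finset.union_subset hC.1 hC'.1)
                (fun e he hxe => by rw [hx' e he hxe]; exact Finset.mem_union_left _ hC.2.1)
                (fun e he hxe => by rw [hz' e he hxe]; exact Finset.mem_union_right _ hC'.2.1)
              have h2 := hall' (C ∩ C') (Finset.inter_subset_left.trans hC.1)
              have h3 := Finset.sum_union_inter (s₁ := C) (s₂ := C') (f := c)
              have h4 := Finset.sum_union_inter (s₁ := absorbed K A C)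
                (s₂ := absorbed K A C') (f := w)
              have h5 : absorbed K A C ∩ absorbed K A C' = absorbed K A (C ∩ C') := by
                ext f
                simp only [absorbed, Finset.mem_inter, Finset.mem_filter]
                grind
              have h6 : weight w (absorbed K A C ∪ absorbed K A C') ≤
                  weight w (absorbed K A (C ∪ C')) := by
                refine weight_mono ?_ fun e he => hw' e (Finset.mem_filter.1 he).1
                intro f
                simp only [absorbed, Finset.mem_union, Finset.mem_filter]
                grind
              rw [h5] at h4
              simp only [weight] at *
              linarith)
          refine ⟨t, u - t, ht0, by linarith, by ring, fun h => absurd hxe₁ (h _ he₁),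
            fun h => absurd hze₂ (h _ he₂), fun C hC => ?_⟩
          have hxC : (∃ e ∈ C, x ∈ e) ↔ e₁ ∈ C :=
            ⟨fun ⟨e, he, h⟩ => hx' e (hC he) h ▸ he, fun h => ⟨_, h, hxe₁⟩⟩
          have hzC : (∃ e ∈ C, z ∈ e) ↔ e₂ ∈ C :=
            ⟨fun ⟨e, he, h⟩ => hz' e (hC he) h ▸ he, fun h => ⟨_, h, hze₂⟩⟩
          simp only [hxC, hzC]
          by_cases h₁ : e₁ ∈ C <;> by_cases h₂ : e₂ ∈ C
          · have := hfull C hC (fun e he hxe => by rwa [hx' e he hxe])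
              (fun e he hxe => by rwa [hz' e he hxe])
            simp only [h₁, h₂, if_true]
            linarith
          · have := hS C (by simp [hC, h₁, h₂])
            simp only [h₁, h₂, if_true, if_false]
            linarith
          · have := hT C (by simp [hC, h₁, h₂])
            simp only [h₁, h₂, if_true, if_false]
            linarith
          · have := hall' C hC
            simp only [h₁, h₂, if_false]
            linarith
        · push Not at hz
          refine ⟨u, 0, hu0, le_rfl, by ring, fun h => absurd hxe₁ (h _ he₁), fun _ => rfl,
            fun C hC => ?_⟩
          have := hall' C hC
          by_cases h₁ : ∃ e ∈ C, x ∈ e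
          · obtain ⟨e, he, hxe⟩ := h₁
            have := hfull C hC (fun e' he' hxe' => by
              rwa [hA.eq_of_mem he' (hC he) hxe' hxe]) (fun e he hze => absurd hze (hz e he))
            split_ifs <;> linarith
          · rw [if_neg h₁]
            split_ifs <;> linarith
      · push Not at hx
        by_cases hz : ∃ e ∈ A, z ∈ e
        · obtain ⟨e₂, he₂, hze₂⟩ := hz
          refine ⟨0, u, le_rfl, hu0, by ring, fun _ => rfl, fun h => absurd hze₂ (h _ he₂),
            fun C hC => ?_⟩
          have := hall' C hC
          by_cases h₂ : ∃ e ∈ C, z ∈ e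
          · obtain ⟨e, he, hze⟩ := h₂
            have := hfull C hC (fun e he hxe => absurd hxe (hx e he)) (fun e' he' hxe' => by
              rwa [hA.eq_of_mem he' (hC he) hxe' hze])
            split_ifs <;> linarith
          · rw [if_neg h₂]
            split_ifs <;> linarith
        · push Not at hz
          -- An edge with no neighbour in `A` is absorbed by the empty set, so Hall's condition
          -- forces its weight to be zero.
          have h0 := hfull ∅ (by simp) (fun e he h => absurd h (hx e he))
            (fun e he h => absurd h (hz e he))
          have h1 : 0 ≤ weight w (absorbed K A ∅) :=
            Finset.sum_nonneg fun e he => hw' e (Finset.mem_filter.1 he).1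
          simp only [Finset.sum_empty] at h0
          refine ⟨0, 0, le_rfl, le_rfl, by linarith, fun _ => rfl, fun _ => rfl, fun C hC => ?_⟩
          have := hall' C hC
          split_ifs <;> linarith
    obtain ⟨t, s, ht, hs, hts, htx, hsz, hC⟩ := hsplit
    obtain ⟨α, h0, hαA, hαK, hsum, hcap⟩ := ih (hK.subset (Finset.subset_insert _ _))
      (fun e he => hKd e (Finset.mem_insert_of_mem he)) hw'
      (fun e => c e - (if x ∈ e then t else 0) - (if z ∈ e then s else 0)) (by
        intro C hCA
        rw [Finset.sum_sub_distrib, Finset.sum_sub_distrib, sum_ite_mem hA hCA,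
          sum_ite_mem hA hCA]
        exact hC C hCA)
    have hαx := hαK x hxK
    have hαz := hαK z hzK
    refine ⟨fun v => α v + (if v = x then t else 0) + (if v = z then s else 0), ?_, ?_, ?_, ?_, ?_⟩
    · intro v
      have := h0 v
      dsimp only
      split_ifs <;> linarith
    · intro v hv
      have := hαA v hv
      dsimp only
      split_ifs with h1 h2 h3
      · exact absurd (h1.symm.trans h2) hxz
      · subst h1; rw [this, htx hv]; ring
      · subst h3; rw [this, hsz hv]; ring
      · rw [this]; ring
    · intro v hv
      have hvx : v ≠ x := fun h => hv _ (Finset.mem_insert_self _ _) (by simp [h])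
      have hvz : v ≠ z := fun h => hv _ (Finset.mem_insert_self _ _) (by simp [h])
      simp [hvx, hvz, hαK v fun f hf => hv f (Finset.mem_insert_of_mem hf)]
    · intro a b hab
      rcases Finset.mem_insert.1 hab with h | h
      · rw [h, ← hu, ← hts]
        rcases Sym2.eq_iff.1 h with ⟨rfl, rfl⟩ | ⟨rfl, rfl⟩
        · simp [hxz, hxz.symm, hαx, hαz]
        · simp [hxz, hxz.symm, hαx, hαz]; ring
      · have hax : a ≠ x := fun h' => hxK _ h (by simp [h'])
        have haz : a ≠ z := fun h' => hzK _ h (by simp [h'])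
        have hbx : b ≠ x := fun h' => hxK _ h (by simp [h'])
        have hbz : b ≠ z := fun h' => hzK _ h (by simp [h'])
        simpa [hax, haz, hbx, hbz] using hsum a b h
    · intro a b hab
      have hne : a ≠ b := by simpa using hAd _ hab
      have := hcap a b hab
      simp only [Sym2.mem_iff] at this
      dsimp only
      have e1 : (if a = x then t else 0) + (if b = x then t else 0) =
          if x = a ∨ x = b then t else 0 := by grind
      have e2 : (if a = z then s else 0) + (if b = z then s else 0) =
          if z = a ∨ z = b then s else 0 := by grind
      linarith

end Shares

/-! ### The invariants and the constant θ = 1 - 1/k -/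

/-- The structural properties of the states reached while reading the edges of `E`. -/
structure WellFormed {V : Type*} (E : Set (Sym2 V)) (σ : State V) : Prop where
  mem : ∀ e ∈ σ.M, e ∈ E
  nonadj : PairwiseNonadjacent σ.M
  shadow : ∀ e a s, σ.Shadow e a s → e ∈ σ.M ∧ a ∈ e ∧ a ∈ s ∧ s ∈ E ∧ s ≠ e

/-- `1 - 1 / k`. -/
noncomputable def theta (k : ℝ) : ℝ := (k - 1) / k

/-- The amount that the vertex `v` can contribute to the weight of an optimal matching, where `X`
is the set of vertices covered by the part of the optimal matching that was read, `B` is the pledge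
relation and `P` gives the loans. -/
noncomputable def value {V : Type*} (k : ℝ) (w : Sym2 V → ℝ) (M : Finset (Sym2 V)) (X : Set V)
    (B : V → V → Prop) (P : V → ℝ) (v : V) : ℝ :=
  if v ∈ X then (if ∃ y, B y v then theta k / k else k) * cov w M v else P v

/-- The accounting invariant. `O` is the weight of the part of the optimal matching that was read,
and `d` is the total weight of the edges that were removed from `M`. A pledge `B y z` says that the
edge `xy` of `M` has the shadow-edge `xz` at `x`, that no optimal edge at `y` was read and that one
at `z` was; it backs the loan `P y`. -/
structure Ledger {V : Type*} [Fintype V] (k : ℝ) (w : Sym2 V → ℝ) (σ : State V) (X : Set V)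
    (O d : ℝ) (B : V → V → Prop) (P : V → ℝ) : Prop where
  nonneg : ∀ v, 0 ≤ P v
  pledge : ∀ y z, B y z → y ∉ X ∧ z ∈ X ∧
    ∃ x, s(x, y) ∈ σ.M ∧ σ.Shadow s(x, y) x s(x, z) ∧ P y ≤ theta k * w s(x, z)
  inj : ∀ y y' z, B y z → B y' z → y = y'
  supp : ∀ y, (∀ z, ¬ B y z) → P y = 0
  cap : ∀ x y, s(x, y) ∈ σ.M → P x + P y ≤ theta k / k * w s(x, y)
  energy : O ≤ (k - theta k ^ 2) * d + ∑ v, value k w σ.M X B P v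
  dead : (k - 1) * d ≤ weight w σ.M

section Theta

variable {k : ℝ}

lemma theta_mul (hk : 1 < k) : theta k * k = k - 1 := by
  rw [theta]; field_simp

lemma theta_pos (hk : 1 < k) : 0 < theta k := div_pos (by linarith) (by linarith)

lemma theta_lt_one (hk : 1 < k) : theta k < 1 := by
  rw [theta, div_lt_one (by linarith)]; linarith

/-- This identity balances the accounts: demands totalling θw on a removed edge of weight w cover a
loan at its cap (θ/k)w together with the θ²w missing from the charge (k - θ²)w. -/
lemma theta_div (hk : 1 < k) : theta k / k = theta k - theta k ^ 2 := by
  have h := theta_mul hk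
  rw [div_eq_iff (by linarith)]
  nlinarith

lemma theta_sq_le (hk : 1 < k) : theta k ^ 2 ≤ theta k := by
  nlinarith [theta_pos hk, theta_lt_one hk]

lemma theta_le_sub_one (hk : 1 < k) : theta k ≤ k - 1 := by
  nlinarith [theta_pos hk, theta_lt_one hk, theta_mul hk]

end Theta

/-! ### Inserting a locally optimal set -/

section Insert

variable {V : Type*} {k : ℝ} {w : Sym2 V → ℝ} {E : Set (Sym2 V)} {σ : State V} {y : Sym2 V}
  {A : Finset (Sym2 V)}

lemma WellFormed.tagged_mem (h : WellFormed E σ) {e : Sym2 V} (he : e ∈ σ.tagged y)  :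
    e ∈ insert y E := by
  rcases he with rfl | ⟨v, _, he, _⟩ | ⟨v, _, g, _, he⟩ | ⟨v, _, g, a, _, _, he, _⟩
  · exact Set.mem_insert _ _
  · exact Set.mem_insert_of_mem _ (h.mem _ he)
  · exact Set.mem_insert_of_mem _ (h.shadow _ _ _ he).2.2.2.1
  · exact Set.mem_insert_of_mem _ (h.mem _ he)

lemma not_mem_of_mem_sdiff_touching {M : Finset (Sym2 V)} {e f : Sym2 V}
    (he : e ∈ M \ touching M A) (hf : f ∈ A) {v : V} (hve : v ∈ e) : v ∉ f := fun hvf =>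
  (Finset.mem_sdiff.1 he).2 (mem_touching_of_mem (Finset.mem_sdiff.1 he).1 hf hve hvf)

lemma disjoint_sdiff_touching {M : Finset (Sym2 V)} (hAM : ∀ e ∈ A, e ∉ M) :
    Disjoint (M \ touching M A) A :=
  Finset.disjoint_left.2 fun e he heA => hAM e heA (Finset.mem_sdiff.1 he).1

lemma pairwiseNonadjacent_insert {M : Finset (Sym2 V)} (hM : PairwiseNonadjacent M)
    (hA : PairwiseNonadjacent A) : PairwiseNonadjacent ((M \ touching M A) ∪ A) := by
  intro e he f hf hne ⟨v, hve, hvf⟩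
  rcases Finset.mem_union.1 he with he | he <;> rcases Finset.mem_union.1 hf with hf | hf
  · exact hne (hM.eq_of_mem (Finset.mem_sdiff.1 he).1 (Finset.mem_sdiff.1 hf).1 hve hvf)
  · exact not_mem_of_mem_sdiff_touching he hf hve hvf
  · exact not_mem_of_mem_sdiff_touching hf he hvf hve
  · exact hne (hA.eq_of_mem he hf hve hvf)

lemma WellFormed.insert (h : WellFormed E σ) (hA : σ.IsAugmenting y A) :
    WellFormed (insert y E) (σ.insert A) where
  mem e he := by
    rcases Finset.mem_union.1 he with he | he
    · exact Set.mem_insert_of_mem _ (h.mem e (Finset.mem_sdiff.1 he).1)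
    · exact h.tagged_mem (hA.1 e he)
  nonadj := pairwiseNonadjacent_insert h.nonadj hA.2.2
  shadow e a s hs := by
    rcases hs with ⟨he, hs⟩ | ⟨he, hs, hae, has⟩
    · obtain ⟨_, h1, h2, h3, h4⟩ := h.shadow _ _ _ hs
      exact ⟨Finset.mem_union_left _ he, h1, h2, Set.mem_insert_of_mem _ h3, h4⟩
    · have hsM := touching_subset _ _ hs
      refine ⟨Finset.mem_union_right _ he, hae, has, Set.mem_insert_of_mem _ (h.mem _ hsM), ?_⟩
      rintro rfl
      exact hA.2.1 _ he hsM

/-- Lets an iteration that changes nothing count as an insertion. Well-formedness matters: an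
insertion would forget shadow-edges stored for edges outside `M`. -/
lemma WellFormed.insert_empty (h : WellFormed E σ) : σ.insert ∅ = σ := by
  have ht : touching σ.M ∅ = ∅ := by simp [touching]
  refine State.ext ?_ ?_
  · simp [State.insert, ht]
  · funext e a s
    simp only [State.insert, ht, Finset.sdiff_empty, Finset.notMem_empty, false_and, or_false,
      eq_iff_iff, and_iff_right_iff_imp]
    exact fun hs => (h.shadow _ _ _ hs).1

/-- An inserted set shares out the weight of the removed edges. -/
lemma exists_insert_shares (hk : 1 < k) {M : Finset (Sym2 V)} (hM : PairwiseNonadjacent M)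
    (hMd : ∀ e ∈ M, ¬ e.IsDiag) (hMw : ∀ e ∈ M, 0 ≤ w e) (hA : PairwiseNonadjacent A)
    (hAd : ∀ e ∈ A, ¬ e.IsDiag)
    (hmax : ∀ C ⊆ A, weight w C - k * weight w (touching M C) ≤
      weight w A - k * weight w (touching M A)) :
    ∃ α : V → ℝ, (∀ v, 0 ≤ α v) ∧ (∀ v, (∀ e ∈ A, v ∉ e) → α v = 0) ∧
      (∀ v, (∀ f ∈ touching M A, v ∉ f) → α v = 0) ∧
      (∀ x z, s(x, z) ∈ touching M A → α x + α z = w s(x, z)) ∧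
      ∀ x y, s(x, y) ∈ A → α x + α y ≤ w s(x, y) / k := by
  have hsub := touching_subset M A
  refine exists_shares hA hAd _ (hM.subset hsub) (fun e he => hMd e (hsub he))
    (fun e he => hMw e (hsub he)) (fun e => w e / k) fun C hC => ?_
  -- Dropping `C` from `A` saves at least the absorbed edges from removal, so maximality gives k
  -- times their weight at most w(C), which is Hall's condition with capacities w/k.
  have h1 := hmax (A \ C) Finset.sdiff_subset
  rw [weight_sdiff hC] at h1
  have h2 : touching M (A \ C) ⊆ touching M A \ absorbed (touching M A) A C := by
    intro f hf
    obtain ⟨hfM, e, he, hfe⟩ := mem_touching.1 hf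
    obtain ⟨heA, heC⟩ := Finset.mem_sdiff.1 he
    refine Finset.mem_sdiff.2 ⟨mem_touching.2 ⟨hfM, e, heA, hfe⟩, fun h => heC ?_⟩
    exact (Finset.mem_filter.1 h).2 e heA hfe
  have h3 := weight_mono (w := w) h2 fun e he => hMw e (hsub (Finset.mem_sdiff.1 he).1)
  rw [weight_sdiff (show absorbed _ A C ⊆ _ from Finset.filter_subset _ _)] at h3
  rw [← Finset.sum_div, le_div_iff₀ (by linarith)]
  change _ ≤ weight w C
  nlinarith

/-- The accounting invariant survives the insertion of a locally optimal set. -/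
theorem Ledger.insert [Fintype V] {X : Set V} {O d : ℝ} {B : V → V → Prop} {P : V → ℝ}
    (hk : 1 < k) (h : Ledger k w σ X O d B P) (hM : PairwiseNonadjacent σ.M)
    (hMd : ∀ e ∈ σ.M, ¬ e.IsDiag) (hMw : ∀ e ∈ σ.M, 0 ≤ w e) (hA : PairwiseNonadjacent A)
    (hAM : ∀ e ∈ A, e ∉ σ.M) (hAd : ∀ e ∈ A, ¬ e.IsDiag) (hAw : ∀ e ∈ A, 0 ≤ w e)
    (hmax : ∀ C ⊆ A, σ.gain k w C ≤ σ.gain k w A) :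
    ∃ B' P', Ledger k w (σ.insert A) X O (d + weight w (touching σ.M A)) B' P' := by
  obtain ⟨α, hα0, hαA, hαK, hαw, hαc⟩ := exists_insert_shares hk hM hMd hMw hA hAd hmax
  have hθ := theta_pos hk
  have hθ1 := theta_lt_one hk
  have hθk := theta_div hk
  have hθs := theta_sq_le hk
  have hθl := theta_le_sub_one hk
  have hM' : PairwiseNonadjacent (σ.insert A).M := pairwiseNonadjacent_insert hM hA
  have hKM := touching_subset σ.M A
  set K := touching σ.M A
  set S := σ.M \ K
  have hSM : S ⊆ σ.M := Finset.sdiff_subset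
  have hMS : (σ.insert A).M = S ∪ A := rfl
  have hSA : ∀ e ∈ S, ∀ v ∈ e, ∀ f ∈ A, v ∉ f := fun e he v hv f hf =>
    not_mem_of_mem_sdiff_touching he hf hv
  have hSK : ∀ e ∈ S, ∀ v ∈ e, ∀ f ∈ K, v ∉ f := fun e he v hv f hf hvf =>
    (Finset.mem_sdiff.1 he).2 (hM.eq_of_mem (hSM he) (hKM hf) hv hvf ▸ hf)
  have hM'w : ∀ e ∈ (σ.insert A).M, 0 ≤ w e := fun e he => by
    rcases Finset.mem_union.1 he with he | he
    · exact hMw e (hSM he)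
    · exact hAw e he
  have hc0' : ∀ v, 0 ≤ cov w (σ.insert A).M v := fun v => cov_nonneg hM'w v
  -- `N x` marks the gap: x is outside `X`, while z, the other end of its removed edge, has full
  -- value. If the inserted edge xy also has y outside `X`, then y borrows θ times `α x` and z is
  -- pledged. Requiring z to be free of pledges preserves `inj`.
  let N : V → Prop := fun x => x ∉ X ∧ ∃ z, s(x, z) ∈ K ∧ z ∈ X ∧ ¬ ∃ y, B y z
  let B' : V → V → Prop := fun y z => (B y z ∧ ∃ e ∈ S, y ∈ e) ∨
    ∃ x, s(x, y) ∈ A ∧ s(x, z) ∈ K ∧ x ∉ X ∧ y ∉ X ∧ z ∈ X ∧ ¬ ∃ y, B y z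
  let P' : V → ℝ := fun y => if ∃ e ∈ S, y ∈ e then P y else
    if h : ∃ x, s(x, y) ∈ A ∧ N x ∧ y ∉ X then theta k * α h.choose else 0
  have hP'S : ∀ y, (∃ e ∈ S, y ∈ e) → P' y = P y := fun y hy => if_pos hy
  have hP'N : ∀ x y, s(x, y) ∈ A → N x → y ∉ X → P' y = theta k * α x := by
    intro x y hxy hx hy
    have h1 : ¬ ∃ e ∈ S, y ∈ e := fun ⟨e, he, hye⟩ => hSA e he y hye _ hxy (Sym2.mem_mk_right x y)
    have h2 : ∃ x, s(x, y) ∈ A ∧ N x ∧ y ∉ X := ⟨x, hxy, hx, hy⟩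
    simp only [P', if_neg h1, dif_pos h2]
    rw [hA.left_unique h2.choose_spec.1 hxy]
  have hP'0 : ∀ y, (¬ ∃ e ∈ S, y ∈ e) → (¬ ∃ x, s(x, y) ∈ A ∧ N x ∧ y ∉ X) → P' y = 0 := by
    intro y h1 h2
    simp only [P', if_neg h1, dif_neg h2]
  have hP'nn : ∀ y, 0 ≤ P' y := by
    intro y
    simp only [P']
    split_ifs
    · exact h.nonneg y
    · exact mul_nonneg hθ.le (hα0 _)
    · exact le_rfl
  have hP'A : ∀ x y, s(x, y) ∈ A → P' y ≤ theta k * α x := by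
    intro x y hxy
    by_cases hx : N x ∧ y ∉ X
    · exact (hP'N x y hxy hx.1 hx.2).le
    · rw [hP'0 y]
      · exact mul_nonneg hθ.le (hα0 _)
      · exact fun ⟨e, he, hye⟩ => hSA e he y hye _ hxy (Sym2.mem_mk_right x y)
      · rintro ⟨x', hx', h1⟩
        rw [hA.left_unique hx' hxy] at h1
        exact hx h1
  have hT' : ∀ x z, s(x, z) ∈ K → x ∈ X → (∃ y, B' y z) → ∃ y, B y z := by
    rintro x z hxz hx ⟨y, hy | ⟨x', _, hx', hx'X, _⟩⟩
    · exact ⟨y, hy.1⟩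
    · rw [(hM.subset hKM).left_unique hx' hxz] at hx'X
      exact absurd hx hx'X
  refine ⟨B', P', hP'nn, ?_, ?_, ?_, ?_, ?_, ?_⟩
  · rintro y z (⟨hB, e, he, hye⟩ | ⟨x, hxy, hxz, hx, hy, hz, hT⟩)
    · obtain ⟨h1, h2, x, h3, h4, h5⟩ := h.pledge y z hB
      have hxS : s(x, y) ∈ S := by
        rwa [hM.eq_of_mem h3 (hSM he) (Sym2.mem_mk_right x y) hye]
      exact ⟨h1, h2, x, Finset.mem_union_left _ hxS, Or.inl ⟨hxS, h4⟩,
        by rwa [hP'S y ⟨e, he, hye⟩]⟩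
    · refine ⟨hy, hz, x, Finset.mem_union_right _ hxy,
        Or.inr ⟨hxy, hxz, Sym2.mem_mk_left _ _, Sym2.mem_mk_left _ _⟩, ?_⟩
      refine (hP'A x y hxy).trans (mul_le_mul_of_nonneg_left ?_ hθ.le)
      linarith [hαw x z hxz, hα0 z]
  · rintro y y' z (⟨hB, _⟩ | ⟨x, hxy, hxz, -, -, -, hT⟩) (⟨hB', _⟩ | ⟨x', hxy', hxz', -, -, -, hT'⟩)
    · exact h.inj _ _ _ hB hB'
    · exact absurd ⟨y, hB⟩ hT'
    · exact absurd ⟨y', hB'⟩ hT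
    · obtain rfl := (hM.subset hKM).left_unique hxz hxz'
      exact hA.right_unique hxy hxy'
  · intro y hy
    by_cases hyS : ∃ e ∈ S, y ∈ e
    · rw [hP'S y hyS]
      exact h.supp y fun z hz => hy z (Or.inl ⟨hz, hyS⟩)
    · refine hP'0 y hyS ?_
      rintro ⟨x, hxy, ⟨hx, z, hxz, hz, hT⟩, hyX⟩
      exact hy z (Or.inr ⟨x, hxy, hxz, hx, hyX, hz, hT⟩)
  · intro x y hxy
    rcases Finset.mem_union.1 hxy with hxy | hxy
    · rw [hP'S x ⟨_, hxy, Sym2.mem_mk_left _ _⟩, hP'S y ⟨_, hxy, Sym2.mem_mk_right _ _⟩]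
      exact h.cap x y (hSM hxy)
    · have h1 := hP'A x y hxy
      have h2 := hP'A y x (by rwa [Sym2.eq_swap])
      have h3 := hαc x y hxy
      calc P' x + P' y ≤ theta k * (α x + α y) := by linarith
        _ ≤ theta k * (w s(x, y) / k) := mul_le_mul_of_nonneg_left h3 hθ.le
        _ = theta k / k * w s(x, y) := by ring
  · -- the energy estimate
    set val := value k w σ.M X B P with hval
    set val' := value k w (σ.insert A).M X B' P' with hval'
    have hval0' : ∀ v, 0 ≤ val' v := by
      intro v
      simp only [hval', value]
      split_ifs
      · exact mul_nonneg (div_nonneg hθ.le (by linarith)) (hc0' v)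
      · exact mul_nonneg (by linarith) (hc0' v)
      · exact hP'nn v
    -- The amount that x demands from its inserted edge. The coefficient k + θ² completes k - θ² to
    -- 2k, the value of a removed edge whose two endpoints are in `X` and free of pledges.
    let dem : V → ℝ := fun x => if x ∈ X then
      (if ∃ y, B' y x then theta k * α x else (k + theta k ^ 2) * α x)
      else if N x then theta k * α x else 0
    have hθα : ∀ x, 0 ≤ theta k * α x := fun x => mul_nonneg hθ.le (hα0 x)
    have hkα : ∀ x, theta k * α x ≤ (k + theta k ^ 2) * α x := fun x =>
      mul_le_mul_of_nonneg_right (by nlinarith) (hα0 x)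
    have hdem0 : ∀ x, 0 ≤ dem x := by
      intro x
      have := hθα x
      have := hkα x
      simp only [dem]
      split_ifs <;> linarith
    have hdemle : ∀ x, dem x ≤ (k + theta k ^ 2) * α x := by
      intro x
      have := hθα x
      have := hkα x
      simp only [dem]
      split_ifs <;> linarith
    have hdemθ : ∀ x, (x ∈ X → ∃ y, B' y x) → dem x ≤ theta k * α x := by
      intro x hx
      have := hθα x
      simp only [dem]
      split_ifs with h1 h2
      · linarith
      · exact absurd (hx h1) h2
      · linarith
      · linarith
    have hdemX : ∀ x ∈ X, theta k * α x ≤ dem x := by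
      intro x hx
      have := hkα x
      simp only [dem, if_pos hx]
      split_ifs <;> linarith
    have hdemX' : ∀ x ∈ X, (¬ ∃ y, B' y x) → dem x = (k + theta k ^ 2) * α x := by
      intro x hx hT
      simp only [dem, if_pos hx, if_neg hT]
    have hdemN : ∀ x, N x → dem x = theta k * α x := by
      intro x hx
      simp only [dem, if_neg hx.1, if_pos hx]
    have hdemz : ∀ x, α x = 0 → dem x = 0 := fun x hx => le_antisymm
      (by simpa [hx] using hdemle x) (hdem0 x)
    -- each removed edge is paid for
    have hKpay : ∀ x z, s(x, z) ∈ K →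
        val x + val z ≤ (k - theta k ^ 2) * w s(x, z) + dem x + dem z := by
      -- When some endpoint is in `X`, symmetry allows x to be in `X` and, if both are, to be
      -- pledged only when z is.
      have aux : ∀ x z, s(x, z) ∈ K → x ∈ X → (z ∈ X → (∃ y, B y x) → ∃ y, B y z) →
          val x + val z ≤ (k - theta k ^ 2) * w s(x, z) + dem x + dem z := by
        intro x z hxz hx hsym
        have hzx : s(z, x) ∈ K := by rwa [Sym2.eq_swap]
        have hxM := hKM hxz
        have hu := hMw _ hxM
        have e1 := hαw x z hxz
        have c1 : cov w σ.M x = w s(x, z) := cov_eq hM hxM (Sym2.mem_mk_left _ _)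
        have c2 : cov w σ.M z = w s(x, z) := cov_eq hM hxM (Sym2.mem_mk_right _ _)
        have hPz : P z ≤ theta k / k * w s(x, z) := by linarith [h.cap x z hxM, h.nonneg x]
        have hd1 := hdem0 x
        have hd2 := hdem0 z
        have hd3 := hdemX x hx
        simp only [hval, value, if_pos hx, c1, c2]
        rw [← e1] at *
        have hαx := hα0 x
        have hαz := hα0 z
        rw [hθk] at *
        by_cases hz : z ∈ X
        · have hd4 := hdemX z hz
          rw [if_pos hz]
          by_cases hTz : ∃ y, B y z
          · rw [if_pos hTz]
            split_ifs <;> nlinarith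
          · have hTx : ¬ ∃ y, B y x := fun h => hTz (hsym hz h)
            rw [if_neg hTz, if_neg hTx, hdemX' x hx fun h => hTx (hT' z x hzx hz h),
              hdemX' z hz fun h => hTz (hT' x z hxz hx h)]
            nlinarith
        · rw [if_neg hz]
          by_cases hTx : ∃ y, B y x
          · rw [if_pos hTx]
            nlinarith
          -- The tight case: the demands at x and z total at least θw, exactly the missing θ²w plus
          -- the largest loan (θ/k)w that z may hold.
          · rw [if_neg hTx]
            have := hdemN z ⟨hz, x, hzx, hx, hTx⟩
            nlinarith
      intro x z hxz
      have hzx : s(z, x) ∈ K := by rwa [Sym2.eq_swap]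
      by_cases hx : x ∈ X
      · by_cases hz : z ∈ X
        · by_cases hT : (∃ y, B y x) → ∃ y, B y z
          · exact aux x z hxz hx fun _ => hT
          · push Not at hT
            have := aux z x hzx hz fun _ _ => hT.1
            rw [Sym2.eq_swap] at this
            linarith
        · exact aux x z hxz hx fun h => absurd h hz
      · by_cases hz : z ∈ X
        · have := aux z x hzx hz fun h => absurd h hx
          rw [Sym2.eq_swap] at this
          linarith
        · have hu := hMw _ (hKM hxz)
          have hcap := h.cap x z (hKM hxz)
          simp only [hval, value, if_neg hx, if_neg hz]
          have := hdem0 x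
          have := hdem0 z
          rw [hθk] at hcap
          nlinarith
    -- each inserted edge can pay
    have hApay : ∀ x y, s(x, y) ∈ A → dem x + dem y ≤ val' x + val' y := by
      have aux : ∀ x y, s(x, y) ∈ A → x ∈ X → (y ∈ X → (∃ v, B' v x) → ∃ v, B' v y) →
          dem x + dem y ≤ val' x + val' y := by
        intro x y hxy hx hsym
        have hW := hAw _ hxy
        have hc : cov w (σ.insert A).M x = w s(x, y) :=
          cov_eq hM' (Finset.mem_union_right _ hxy) (Sym2.mem_mk_left _ _)
        have h1 := hαc x y hxy
        have h2 := hval0' y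
        by_cases hT : ∃ v, B' v x
        · have h3 : val' x = theta k / k * w s(x, y) := by
            simp only [hval', value, if_pos hx, hc, if_pos hT]
          have h4 := hdemθ x fun _ => hT
          have h5 := hdemθ y fun hy => hsym hy hT
          have h6 := mul_le_mul_of_nonneg_left h1 hθ.le
          have h7 : theta k * (w s(x, y) / k) = theta k / k * w s(x, y) := by ring
          linarith
        · have h3 : val' x = k * w s(x, y) := by
            simp only [hval', value, if_pos hx, hc, if_neg hT]
          have h4 := hdemle x
          have h5 := hdemle y
          have h6 := mul_le_mul_of_nonneg_left h1 (show 0 ≤ k + theta k ^ 2 by positivity)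
          have h7 : (k + theta k ^ 2) * (w s(x, y) / k) ≤ k * w s(x, y) := by
            have : (k + theta k ^ 2) * (w s(x, y) / k) = (k + theta k ^ 2) / k * w s(x, y) := by
              ring
            rw [this]
            refine mul_le_mul_of_nonneg_right ?_ hW
            rw [div_le_iff₀ (by linarith)]
            nlinarith
          linarith
      intro x y hxy
      have hyx : s(y, x) ∈ A := by rwa [Sym2.eq_swap]
      by_cases hx : x ∈ X
      · by_cases hy : y ∈ X
        · by_cases hT : (∃ v, B' v x) → ∃ v, B' v y
          · exact aux x y hxy hx fun _ => hT
          · push Not at hT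
            linarith [aux y x hyx hy fun _ _ => hT.1]
        · exact aux x y hxy hx fun h => absurd h hy
      · by_cases hy : y ∈ X
        · linarith [aux y x hyx hy fun h => absurd h hx]
        · have key : ∀ x y, s(x, y) ∈ A → x ∉ X → y ∉ X → dem x ≤ val' y := by
            intro x y hxy hx hy
            have h1 : val' y = P' y := by simp only [hval', value, if_neg hy]
            rw [h1]
            by_cases hN : N x
            · rw [hdemN x hN, hP'N x y hxy hN hy]
            · have : dem x = 0 := by simp only [dem, if_neg hx, if_neg hN]
              rw [this]
              exact hP'nn y
          linarith [key x y hxy hx hy, key y x hyx hy hx]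
    let a : V → ℝ := fun v => if ∃ e ∈ A, v ∈ e then val' v else 0
    let b : V → ℝ := fun v => if ∃ f ∈ K, v ∈ f then val v else 0
    -- No value is lost away from the removed and inserted edges; the terms `b` and `a` isolate the
    -- old value on the former and the new value on the latter.
    have hab : ∑ v, (val v + a v) ≤ ∑ v, (val' v + b v) := by
      refine Finset.sum_le_sum fun v _ => ?_
      by_cases hvS : ∃ e ∈ S, v ∈ e
      · have hvS' := hvS
        obtain ⟨e, he, hve⟩ := hvS'
        have ha : a v = 0 := if_neg fun ⟨f, hf, hvf⟩ => hSA e he v hve f hf hvf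
        have hb : b v = 0 := if_neg fun ⟨f, hf, hvf⟩ => hSK e he v hve f hf hvf
        rw [ha, hb, add_zero, add_zero]
        simp only [hval, hval', value]
        rw [cov_eq hM (hSM he) hve, cov_eq hM' (Finset.mem_union_left _ he) hve, hP'S v hvS]
        have hwe := hMw e (hSM he)
        split_ifs with h1 h2 h3 h3
        · exact le_rfl
        -- A pledge that disappears with the edge of its borrower returns v to full value.
        · refine mul_le_mul_of_nonneg_right ?_ hwe
          rw [hθk]
          nlinarith
        · exfalso
          obtain ⟨y, hy | ⟨x, _, hx, _⟩⟩ := h3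
          · exact h2 ⟨y, hy.1⟩
          · exact hSK e he v hve _ hx (Sym2.mem_mk_right _ _)
        · exact le_rfl
        · exact le_rfl
      · have ha : a v ≤ val' v := by
          simp only [a]
          split_ifs
          · exact le_rfl
          · exact hval0' v
        have hb : val v ≤ b v := by
          simp only [b]
          split_ifs with hK
          · exact le_rfl
          · have hMv : ∀ e ∈ σ.M, v ∉ e := fun e he hve => by
              by_cases heK : e ∈ K
              · exact hK ⟨e, heK, hve⟩
              · exact hvS ⟨e, Finset.mem_sdiff.2 ⟨he, heK⟩, hve⟩
            have hPv : P v = 0 := h.supp v fun z hz => by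
              obtain ⟨_, _, x, hx, _⟩ := h.pledge v z hz
              exact hMv _ hx (Sym2.mem_mk_right _ _)
            simp [hval, value, cov_eq_zero hMv, hPv]
        linarith
    have hA_sum : ∑ v, (dem v - a v) ≤ ∑ e ∈ A, (0 : ℝ) := by
      refine sum_le_sum_edges hA hAd ?_ ?_
      · intro v hv
        have h1 : a v = 0 := if_neg fun ⟨e, he, hve⟩ => hv e he hve
        rw [h1, hdemz v (hαA v hv), sub_zero]
      · intro x y hxy
        have h1 : a x = val' x := if_pos ⟨_, hxy, Sym2.mem_mk_left _ _⟩
        have h2 : a y = val' y := if_pos ⟨_, hxy, Sym2.mem_mk_right _ _⟩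
        linarith [hApay x y hxy]
    have hK_sum : ∑ v, (b v - dem v) ≤ ∑ e ∈ K, (k - theta k ^ 2) * w e := by
      refine sum_le_sum_edges (hM.subset hKM) (fun e he => hMd e (hKM he)) ?_ ?_
      · intro v hv
        have h1 : b v = 0 := if_neg fun ⟨e, he, hve⟩ => hv e he hve
        rw [h1, hdemz v (hαK v hv), sub_zero]
      · intro x y hxy
        have h1 : b x = val x := if_pos ⟨_, hxy, Sym2.mem_mk_left _ _⟩
        have h2 : b y = val y := if_pos ⟨_, hxy, Sym2.mem_mk_right _ _⟩
        linarith [hKpay x y hxy]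
    rw [← Finset.mul_sum] at hK_sum
    simp only [Finset.sum_add_distrib, Finset.sum_sub_distrib, Finset.sum_const_zero] at *
    have := h.energy
    rw [mul_add, weight]
    linarith
  -- Comparison with the empty set gives w(A) ≥ k w(K), so w(M) grows by at least (k-1) w(K).
  · have h1 := hmax ∅ (by simp)
    simp only [State.gain, weight, touching, Finset.sum_empty, Finset.notMem_empty, false_and,
      exists_false, Finset.filter_false, mul_zero, sub_zero] at h1
    have h2 : weight w (σ.insert A).M = weight w σ.M - weight w K + weight w A := by
      rw [hMS, weight_union (disjoint_sdiff_touching hAM), weight_sdiff hKM]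
    rw [h2, mul_add]
    have h3 : 0 ≤ weight w A - k * weight w K := h1
    linarith [h.dead]

end Insert

/-! ### Exchange argument for a maximizing set -/

section Exchange

variable {V : Type*} {k : ℝ} {w : Sym2 V → ℝ} {σ : State V} {y : Sym2 V} {A : Finset (Sym2 V)}

lemma weight_filter_le_sum_cov {F : Finset (Sym2 V)} (hw : ∀ e ∈ F, 0 ≤ w e) (Q : Finset V) :
    weight w (F.filter fun e => ∃ v ∈ Q, v ∈ e) ≤ ∑ v ∈ Q, cov w F v := by
  simp only [weight, cov, Finset.sum_filter]
  rw [Finset.sum_comm]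
  refine Finset.sum_le_sum fun e he => ?_
  have h0 : ∀ v ∈ Q, 0 ≤ if v ∈ e then w e else 0 := fun v _ => by
    split_ifs
    · exact hw e he
    · exact le_rfl
  split_ifs with h
  · obtain ⟨v, hv, hve⟩ := h
    calc w e = if v ∈ e then w e else 0 := (if_pos hve).symm
      _ ≤ _ := Finset.single_le_sum h0 hv
  · exact Finset.sum_nonneg h0

/-- Maximality of `A` compared with the set obtained by adding `N` to the edges of `A` that avoid
the vertices in `U`. -/
lemma exchange (hk : 1 < k) (hMw : ∀ e ∈ σ.M, 0 ≤ w e) (hAw : ∀ e ∈ A, 0 ≤ w e)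
    (hA : σ.IsAugmenting y A) (hmax : ∀ C, σ.IsAugmenting y C → σ.gain k w C ≤ σ.gain k w A)
    {N : Finset (Sym2 V)} (hN : σ.IsAugmenting y N) (U Q : Finset V)
    (hU : ∀ e ∈ N, ∀ v ∈ e, ∀ f ∈ A, v ∈ f → ∃ u ∈ U, u ∈ f)
    (hQ : ∀ e ∈ N, ∀ v ∈ e, ∀ f ∈ σ.M, v ∈ f → f ∈ touching σ.M A ∨ ∃ u ∈ Q, u ∈ f) :
    weight w N ≤ ∑ u ∈ U, cov w A u + k * ∑ v ∈ Q, cov w (σ.M \ touching σ.M A) v := by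
  set A₁ := A.filter fun e => ∃ u ∈ U, u ∈ e with hA₁
  have hA₁A : A₁ ⊆ A := Finset.filter_subset _ _
  have hmem : ∀ f ∈ A \ A₁, ∀ e ∈ N, ∀ v ∈ e, v ∉ f := by
    intro f hf e he v hve hvf
    obtain ⟨hfA, hf1⟩ := Finset.mem_sdiff.1 hf
    exact hf1 (Finset.mem_filter.2 ⟨hfA, hU e he v hve f hfA hvf⟩)
  have hdisj : Disjoint (A \ A₁) N := Finset.disjoint_left.2 fun f hf hfN => by
    induction f with
    | h a b => exact hmem _ hf _ hfN a (Sym2.mem_mk_left _ _) (Sym2.mem_mk_left _ _)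
  have hC : σ.IsAugmenting y ((A \ A₁) ∪ N) := by
    refine ⟨fun e he => ?_, fun e he => ?_, ?_⟩
    · rcases Finset.mem_union.1 he with he | he
      · exact hA.1 e (Finset.mem_sdiff.1 he).1
      · exact hN.1 e he
    · rcases Finset.mem_union.1 he with he | he
      · exact hA.2.1 e (Finset.mem_sdiff.1 he).1
      · exact hN.2.1 e he
    · intro e he f hf hne ⟨v, hve, hvf⟩
      rcases Finset.mem_union.1 he with he | he <;> rcases Finset.mem_union.1 hf with hf | hf
      · exact hne (hA.2.2.eq_of_mem (Finset.mem_sdiff.1 he).1 (Finset.mem_sdiff.1 hf).1 hve hvf)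
      · exact hmem e he f hf v hvf hve
      · exact hmem f hf e he v hve hvf
      · exact hne (hN.2.2.eq_of_mem he hf hve hvf)
  have h1 := hmax _ hC
  have h2 := weight_filter_le_sum_cov hAw U
  set S := σ.M \ touching σ.M A with hS
  have hSw : ∀ e ∈ S, 0 ≤ w e := fun e he => hMw e (Finset.mem_sdiff.1 he).1
  have h3 := weight_filter_le_sum_cov hSw Q
  -- Edges of `M(A)` are already paid for; only staying edges that meet `Q` can add to the cost.
  have h4 : touching σ.M ((A \ A₁) ∪ N) ⊆
      touching σ.M A ∪ S.filter fun e => ∃ v ∈ Q, v ∈ e := by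
    intro f hf
    obtain ⟨hfM, e, he, v, hvf, hve⟩ := mem_touching.1 hf
    by_cases hfA : f ∈ touching σ.M A
    · exact Finset.mem_union_left _ hfA
    · refine Finset.mem_union_right _ (Finset.mem_filter.2 ⟨Finset.mem_sdiff.2 ⟨hfM, hfA⟩, ?_⟩)
      rcases Finset.mem_union.1 he with he | he
      · exact absurd (mem_touching_of_mem hfM (Finset.mem_sdiff.1 he).1 hvf hve) hfA
      · exact (hQ e he v hve f hfM hvf).resolve_left hfA
  have hKw : ∀ e ∈ touching σ.M A, 0 ≤ w e := fun e he => hMw e (touching_subset _ _ he)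
  have h5 := (weight_mono (w := w) h4 fun e he => by
    rcases Finset.mem_union.1 he with he | he
    · exact hKw e he
    · exact hSw e (Finset.mem_filter.1 he).1).trans (weight_union_le hKw)
  simp only [State.gain] at h1
  rw [weight_union hdisj, weight_sdiff hA₁A] at h1
  have h6 := mul_le_mul_of_nonneg_left (h5.trans (add_le_add_right h3 _))
    (show 0 ≤ k by linarith)
  rw [mul_add] at h6
  linarith

end Exchange

/-! ### Reading an optimal edge and settling its loans -/

section Read

variable {V : Type*} [Fintype V] {k : ℝ} {w : Sym2 V → ℝ} {σ : State V} {X : Set V} {O d : ℝ}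
  {B : V → V → Prop} {P : V → ℝ}

/-- The accounting invariant survives the reading of an optimal edge `y₁y₂` whose weight `u` is
bounded by what its endpoints, and the vertices they are pledged against, can contribute. -/
lemma Ledger.read (hk : 1 < k) (h : Ledger k w σ X O d B P) (hMw : ∀ e ∈ σ.M, 0 ≤ w e)
    {y₁ y₂ : V} (hne : y₁ ≠ y₂) (hy₁ : y₁ ∉ X) (hy₂ : y₂ ∉ X) {u ζ₁ ζ₂ : ℝ}
    (hζ₁ : ζ₁ ≤ 0 ∨ ∃ z, B y₁ z ∧ ζ₁ ≤ (k - theta k / k) * cov w σ.M z)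
    (hζ₂ : ζ₂ ≤ 0 ∨ ∃ z, B y₂ z ∧ ζ₂ ≤ (k - theta k / k) * cov w σ.M z)
    (hu : u ≤ (k * cov w σ.M y₁ - P y₁) + (k * cov w σ.M y₂ - P y₂) + ζ₁ + ζ₂) :
    ∃ B' P', Ledger k w σ (X ∪ {y₁, y₂}) (O + u) d B' P' := by
  have hθ := theta_pos hk
  have hθk := theta_div hk
  have hθs := theta_sq_le hk
  have hθl := theta_le_sub_one hk
  have hc0 := cov_nonneg hMw
  -- The contribution ζ is turned into a function concentrated at the pledged vertex, so that the
  -- energy can be compared vertex by vertex.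
  have hγ : ∀ y ζ, (ζ ≤ 0 ∨ ∃ z, B y z ∧ ζ ≤ (k - theta k / k) * cov w σ.M z) →
      ∃ γ : V → ℝ, ζ ≤ ∑ v, γ v ∧
        ∀ v, (B y v → γ v ≤ (k - theta k / k) * cov w σ.M v) ∧ (¬ B y v → γ v ≤ 0) := by
    rintro y ζ (hζ | ⟨z, hz, hζ⟩)
    · refine ⟨fun _ => 0, by simpa using hζ, fun v => ⟨fun _ => ?_, fun _ => le_rfl⟩⟩
      exact mul_nonneg (by rw [hθk]; nlinarith) (hc0 v)
    · refine ⟨fun v => if v = z then (k - theta k / k) * cov w σ.M z else 0, by simpa using hζ,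
        fun v => ⟨fun _ => ?_, fun hv => ?_⟩⟩
      · dsimp only
        split_ifs with hvz
        · rw [hvz]
        · exact mul_nonneg (by rw [hθk]; nlinarith) (hc0 v)
      · have : v ≠ z := fun hvz => hv (hvz ▸ hz)
        simp [this]
  obtain ⟨γ₁, hs₁, hγ₁⟩ := hγ y₁ ζ₁ hζ₁
  obtain ⟨γ₂, hs₂, hγ₂⟩ := hγ y₂ ζ₂ hζ₂
  have hBX : ∀ y z, B y z → z ∈ X := fun y z hB => (h.pledge y z hB).2.1
  let B' : V → V → Prop := fun y z => B y z ∧ y ≠ y₁ ∧ y ≠ y₂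
  let P' : V → ℝ := fun v => if v = y₁ ∨ v = y₂ then 0 else P v
  have hP'P : ∀ v, P' v ≤ P v := by
    intro v
    have := h.nonneg v
    simp only [P']
    split_ifs <;> linarith
  refine ⟨B', P', ?_, ?_, ?_, ?_, ?_, ?_, h.dead⟩
  · intro v
    simp only [P']
    split_ifs
    · exact le_rfl
    · exact h.nonneg v
  · rintro y z ⟨hB, h1, h2⟩
    obtain ⟨hy, hz, x, h3, h4, h5⟩ := h.pledge y z hB
    exact ⟨by simp [hy, h1, h2], Or.inl hz, x, h3, h4, (hP'P y).trans h5⟩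
  · rintro y y' z ⟨hB, _⟩ ⟨hB', _⟩
    exact h.inj _ _ _ hB hB'
  · intro y hy
    simp only [P']
    split_ifs with hyy
    · rfl
    · push Not at hyy
      exact h.supp y fun z hz => hy z ⟨hz, hyy⟩
  · intro x y hxy
    linarith [h.cap x y hxy, hP'P x, hP'P y]
  · have key : ∑ v, (value k w σ.M X B P v +
        (if v = y₁ then k * cov w σ.M y₁ - P y₁ else 0) +
        (if v = y₂ then k * cov w σ.M y₂ - P y₂ else 0) + γ₁ v + γ₂ v) ≤
        ∑ v, value k w σ.M (X ∪ {y₁, y₂}) B' P' v := by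
      refine Finset.sum_le_sum fun v _ => ?_
      have aux : ∀ y, y ∉ X → y = y₁ ∨ y = y₂ →
          value k w σ.M (X ∪ {y₁, y₂}) B' P' y = k * cov w σ.M y ∧
          value k w σ.M X B P y = P y ∧ γ₁ y ≤ 0 ∧ γ₂ y ≤ 0 := by
        intro y hy hyy
        have h1 : y ∈ X ∪ {y₁, y₂} := Or.inr hyy
        have h2 : ¬ ∃ v, B' v y := fun ⟨v, hv⟩ => hy (hBX v y hv.1)
        refine ⟨by simp only [value, if_pos h1, if_neg h2], by simp only [value, if_neg hy],
          (hγ₁ y).2 fun hB => hy (hBX _ _ hB), (hγ₂ y).2 fun hB => hy (hBX _ _ hB)⟩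
      by_cases hv₁ : v = y₁
      · subst hv₁
        obtain ⟨e1, e2, e3, e4⟩ := aux v hy₁ (Or.inl rfl)
        rw [e1, e2, if_pos rfl, if_neg hne]
        linarith
      by_cases hv₂ : v = y₂
      · subst hv₂
        obtain ⟨e1, e2, e3, e4⟩ := aux v hy₂ (Or.inr rfl)
        rw [e1, e2, if_pos rfl, if_neg hv₁]
        linarith
      rw [if_neg hv₁, if_neg hv₂]
      by_cases hvX : v ∈ X
      · have h1 : v ∈ X ∪ {y₁, y₂} := Or.inl hvX
        have hcv := hc0 v
        simp only [value, if_pos h1, if_pos hvX]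
        by_cases hB₁ : B y₁ v
        · have hB₂ : ¬ B y₂ v := fun hB => hne (h.inj _ _ _ hB₁ hB)
          have hT : ∃ y, B y v := ⟨_, hB₁⟩
          -- By `inj` this was the only pledge against v; dissolving it raises the coefficient of v
          -- from θ/k to k.
          have hT' : ¬ ∃ y, B' y v := fun ⟨y, hB, hy, _⟩ => hy (h.inj _ _ _ hB hB₁)
          rw [if_pos hT, if_neg hT']
          linarith [(hγ₁ v).1 hB₁, (hγ₂ v).2 hB₂]
        by_cases hB₂ : B y₂ v
        · have hT : ∃ y, B y v := ⟨_, hB₂⟩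
          have hT' : ¬ ∃ y, B' y v := fun ⟨y, hB, _, hy⟩ => hy (h.inj _ _ _ hB hB₂)
          rw [if_pos hT, if_neg hT']
          linarith [(hγ₁ v).2 hB₁, (hγ₂ v).1 hB₂]
        · have hT : (∃ y, B' y v) ↔ ∃ y, B y v :=
            ⟨fun ⟨y, hy⟩ => ⟨y, hy.1⟩, fun ⟨y, hy⟩ => ⟨y, hy, fun h => hB₁ (h ▸ hy),
              fun h => hB₂ (h ▸ hy)⟩⟩
          have := (hγ₁ v).2 hB₁
          have := (hγ₂ v).2 hB₂
          by_cases hTv : ∃ y, B y v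
          · rw [if_pos hTv, if_pos (hT.2 hTv)]
            linarith
          · rw [if_neg hTv, if_neg (hTv ∘ hT.1)]
            linarith
      · have h1 : v ∉ X ∪ {y₁, y₂} := by simp [hvX, hv₁, hv₂]
        have h2 : P' v = P v := by simp [P', hv₁, hv₂]
        simp only [value, if_neg h1, if_neg hvX, h2]
        linarith [(hγ₁ v).2 fun hB => hvX (hBX _ _ hB), (hγ₂ v).2 fun hB => hvX (hBX _ _ hB)]
    simp only [Finset.sum_add_distrib, Finset.sum_ite_eq', Finset.mem_univ, if_true] at key
    linarith [h.energy]

end Read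

/-! ### Comparing with the input edge and its shadow-edges -/

section Augmenting

variable {V : Type*} {k : ℝ} {w : Sym2 V → ℝ} {σ : State V} {y : Sym2 V}
  {A N : Finset (Sym2 V)}

lemma isAugmenting_singleton (hy : y ∉ σ.M) : σ.IsAugmenting y {y} := by
  refine ⟨?_, ?_, ?_⟩
  · simp [State.tagged]
  · simpa using hy
  · intro e he f hf hef
    simp_all

lemma isAugmenting_insert (hN : σ.IsAugmenting y N) {g z : V}
    (ht : s(g, z) ∈ σ.tagged y) (hM : s(g, z) ∉ σ.M) (hg : ∀ f ∈ N, g ∉ f)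
    (hz : ∀ f ∈ N, z ∉ f) : σ.IsAugmenting y (insert s(g, z) N) := by
  have key : ∀ f ∈ N, ∀ v ∈ s(g, z), v ∉ f := by
    intro f hf v hv
    rcases Sym2.mem_iff.1 hv with rfl | rfl
    · exact hg f hf
    · exact hz f hf
  refine ⟨fun e he => ?_, fun e he => ?_, ?_⟩
  · rcases Finset.mem_insert.1 he with rfl | he
    · exact ht
    · exact hN.1 e he
  · rcases Finset.mem_insert.1 he with rfl | he
    · exact hM
    · exact hN.2.1 e he
  · intro e he f hf hne ⟨v, hve, hvf⟩
    rcases Finset.mem_insert.1 he with rfl | he <;> rcases Finset.mem_insert.1 hf with rfl | hf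
    · exact hne rfl
    · exact key f hf v hve hvf
    · exact key e he v hvf hve
    · exact hN.2.2 e he f hf hne ⟨v, hve, hvf⟩

/-- Maximality of `A`, in terms of the matching after the insertion of `A`: every vertex of an edge
of `N` belongs to `Q` or is matched to a vertex of `Q` by an edge that stays. -/
lemma weight_le_sum_cov_insert (hk : 1 < k) (hM : PairwiseNonadjacent σ.M)
    (hMw : ∀ e ∈ σ.M, 0 ≤ w e) (hAw : ∀ e ∈ A, 0 ≤ w e) (hA : σ.IsAugmenting y A)
    (hmax : ∀ C, σ.IsAugmenting y C → σ.gain k w C ≤ σ.gain k w A)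
    (hN : σ.IsAugmenting y N) (Q : Finset V)
    (hQ : ∀ e ∈ N, ∀ v ∈ e, v ∈ Q ∨ ∃ u ∈ Q, s(v, u) ∈ σ.M \ touching σ.M A) :
    weight w N ≤ k * ∑ v ∈ Q, cov w (σ.insert A).M v := by
  -- A vertex outside `Q` lies on a staying edge to `Q`, so no edge of `A` meets it, and the cost of
  -- that staying edge is already counted at its end in `Q`.
  have h1 := exchange hk hMw hAw hA hmax hN Q Q
    (by
      intro e he v hve f hf hvf
      rcases hQ e he v hve with hv | ⟨u, hu, hvu⟩
      · exact ⟨v, hv, hvf⟩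
      · exact absurd hvf (not_mem_of_mem_sdiff_touching hvu hf (Sym2.mem_mk_left _ _)))
    (by
      intro e he v hve f hf hvf
      rcases hQ e he v hve with hv | ⟨u, hu, hvu⟩
      · exact Or.inr ⟨v, hv, hvf⟩
      · refine Or.inr ⟨u, hu, ?_⟩
        rw [hM.eq_of_mem hf (Finset.mem_sdiff.1 hvu).1 hvf (Sym2.mem_mk_left _ _)]
        exact Sym2.mem_mk_right _ _)
  have h2 : ∑ v ∈ Q, cov w (σ.insert A).M v =
      ∑ v ∈ Q, cov w (σ.M \ touching σ.M A) v + ∑ v ∈ Q, cov w A v := by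
    rw [← Finset.sum_add_distrib]
    exact Finset.sum_congr rfl fun v _ => cov_union (disjoint_sdiff_touching hA.2.1) v
  have h3 : 0 ≤ ∑ v ∈ Q, cov w A v := Finset.sum_nonneg fun v _ => cov_nonneg hAw v
  rw [h2]
  nlinarith

/-- If the inserted set covers an endpoint of the input edge, then the inserted edges at its
endpoints weigh at least as much as the input edge. -/
lemma weight_le_of_covered {E : Set (Sym2 V)} (hk : 1 < k) (wf : WellFormed E σ) (hMd : ∀ e ∈ σ.M, ¬ e.IsDiag)
    (hMw : ∀ e ∈ σ.M, 0 ≤ w e) (hAw : ∀ e ∈ A, 0 ≤ w e) {y₁ y₂ : V} (hne : y₁ ≠ y₂) (hyM : s(y₁, y₂) ∉ σ.M)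
    (hA : σ.IsAugmenting s(y₁, y₂) A)
    (hmax : ∀ C, σ.IsAugmenting s(y₁, y₂) C → σ.gain k w C ≤ σ.gain k w A)
    (hcov : ∃ f ∈ A, ∃ v ∈ s(y₁, y₂), v ∈ f) :
    w s(y₁, y₂) ≤ cov w A y₁ + cov w A y₂ := by
  have hN := isAugmenting_singleton hyM
  have htouch : ∀ v ∈ s(y₁, y₂), ∀ f ∈ σ.M, v ∈ f → f ∈ touching σ.M A := by
    obtain ⟨f, hfA, v, hv, hvf⟩ := hcov
    by_cases hfy : f = s(y₁, y₂)
    · intro v hv e he hve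
      exact mem_touching_of_mem he hfA hve (hfy ▸ hv)
    · have hfM := hA.2.1 f hfA
      -- Tagged edges outside `M` are the input edge and shadow-edges, so f is a shadow-edge at g of
      -- some gu in `M`. It differs from gu, hence meets the input edge at its other endpoint v.
      -- Thus f touches gu as well as any edge of `M` at v, and taking the input edge removes
      -- nothing new.
      have : ∃ u ∈ s(y₁, y₂), ∃ g, s(g, u) ∈ σ.M ∧ σ.Shadow s(g, u) g f := by
        rcases hA.1 f hfA with h | ⟨_, _, h, _⟩ | h | ⟨_, _, _, _, _, _, h, _⟩
        · exact absurd h hfy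
        · exact absurd h hfM
        · exact h
        · exact absurd h hfM
      obtain ⟨u, hu, g, hgM, hs⟩ := this
      obtain ⟨_, _, hgf, _, hfe⟩ := wf.shadow _ _ _ hs
      have hvu : v ≠ u := by
        rintro rfl
        by_cases hgv : g = v
        · exact hMd _ hgM (by simpa using hgv)
        · exact hfe ((Sym2.mem_and_mem_iff hgv).1 ⟨hgf, hvf⟩)
      have huv : s(y₁, y₂) = s(v, u) := ((Sym2.mem_and_mem_iff hvu).1 ⟨hv, hu⟩)
      intro x hx e he hxe
      rw [huv] at hx
      rcases Sym2.mem_iff.1 hx with rfl | rfl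
      · exact mem_touching_of_mem he hfA hxe hvf
      · rw [wf.nonadj.eq_of_mem he hgM hxe (Sym2.mem_mk_right _ _)]
        exact mem_touching_of_mem hgM hfA (Sym2.mem_mk_left _ _) hgf
  have := exchange hk hMw hAw hA hmax hN {y₁, y₂} ∅
    (by
      intro e he v hve f hf hvf
      rw [Finset.mem_singleton.1 he] at hve
      exact ⟨v, by simpa using hve, hvf⟩)
    (by
      intro e he v hve f hf hvf
      rw [Finset.mem_singleton.1 he] at hve
      exact Or.inl (htouch v hve f hf hvf))
  simpa [weight, Finset.sum_pair hne] using this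

end Augmenting

/-! ### The weight of an input edge against contributions and loans -/

section Contribution

variable {V : Type*} [Fintype V] {k : ℝ} {w : Sym2 V → ℝ} {E : Set (Sym2 V)} {σ : State V}
  {X : Set V} {O d : ℝ} {B : V → V → Prop} {P : V → ℝ} {A : Finset (Sym2 V)}

lemma Ledger.loan_le {τ : State V} (h : Ledger k w τ X O d B P)
    (hM : PairwiseNonadjacent τ.M) (v : V) : P v ≤ theta k / k * cov w τ.M v := by
  by_cases hv : ∃ e ∈ τ.M, v ∈ e
  · obtain ⟨e, he, hve⟩ := hv
    obtain ⟨x, rfl⟩ := exists_mk_of_mem hve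
    rw [cov_eq hM he hve]
    linarith [h.cap x v he, h.nonneg x]
  · push Not at hv
    rw [cov_eq_zero hv, h.supp v fun z hz => ?_, mul_zero]
    obtain ⟨_, _, x, hx, _⟩ := h.pledge v z hz
    exact hv _ hx (Sym2.mem_mk_right _ _)

/-- A pledge at an endpoint of the input edge that `A` does not cover comes from a shadow-edge that
was stored before the insertion of `A`. -/
lemma Ledger.pledge_insert (h : Ledger k w (σ.insert A) X O d B P) (wf : WellFormed E σ)
    (hEd : ∀ e ∈ E, ¬ e.IsDiag) {y : Sym2 V} {v z : V} (hvy : v ∈ y)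
    (hvA : ∀ e ∈ A, v ∉ e) (hB : B v z) :
    ∃ g, s(g, v) ∈ σ.M \ touching σ.M A ∧ s(g, z) ∈ σ.tagged y ∧
      s(g, z) ∉ σ.M ∧ g ≠ v ∧ z ∈ X ∧ P v ≤ theta k * w s(g, z) := by
  obtain ⟨_, hz, g, hg, hs, hP⟩ := h.pledge v z hB
  have hgA : s(g, v) ∉ A := fun hgA => hvA _ hgA (Sym2.mem_mk_right _ _)
  have hgS := (Finset.mem_union.1 hg).resolve_right hgA
  have hgM := (Finset.mem_sdiff.1 hgS).1
  have hs' : σ.Shadow s(g, v) g s(g, z) := by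
    rcases hs with ⟨_, hs⟩ | ⟨hs, _⟩
    · exact hs
    · exact absurd hs hgA
  obtain ⟨_, _, _, _, hne⟩ := wf.shadow _ _ _ hs'
  refine ⟨g, hgS, Or.inr (Or.inr (Or.inl ⟨v, hvy, g, hgM, hs'⟩)), fun hzM => ?_, ?_, hz, hP⟩
  · exact hne (wf.nonadj.eq_of_mem hzM hgM (Sym2.mem_mk_left _ _) (Sym2.mem_mk_left _ _))
  · simpa using hEd _ (wf.mem _ hgM)

/-- The weight of an input edge is bounded by what its endpoints, and the vertices they are pledged
against, can contribute after the insertion. -/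
theorem Ledger.contribution (hk : 1 < k) (wf : WellFormed E σ) (hEd : ∀ e ∈ E, ¬ e.IsDiag)
    (hMw : ∀ e ∈ σ.M, 0 ≤ w e) (hAw : ∀ e ∈ A, 0 ≤ w e) {y₁ y₂ : V} (hne : y₁ ≠ y₂)
    (hyM : s(y₁, y₂) ∉ σ.M) (hA : σ.IsAugmenting s(y₁, y₂) A)
    (hmax : ∀ C, σ.IsAugmenting s(y₁, y₂) C → σ.gain k w C ≤ σ.gain k w A)
    (h : Ledger k w (σ.insert A) X O d B P) (hy₁ : y₁ ∉ X) (hy₂ : y₂ ∉ X) :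
    ∃ ζ₁ ζ₂, (ζ₁ ≤ 0 ∨ ∃ z, B y₁ z ∧ ζ₁ ≤ (k - theta k / k) * cov w (σ.insert A).M z) ∧
      (ζ₂ ≤ 0 ∨ ∃ z, B y₂ z ∧ ζ₂ ≤ (k - theta k / k) * cov w (σ.insert A).M z) ∧
      w s(y₁, y₂) ≤ (k * cov w (σ.insert A).M y₁ - P y₁) +
        (k * cov w (σ.insert A).M y₂ - P y₂) + ζ₁ + ζ₂ := by
  have hM' : PairwiseNonadjacent (σ.insert A).M := pairwiseNonadjacent_insert wf.nonadj hA.2.2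
  have hM'w : ∀ e ∈ (σ.insert A).M, 0 ≤ w e := fun e he => by
    rcases Finset.mem_union.1 he with he | he
    · exact hMw e (Finset.mem_sdiff.1 he).1
    · exact hAw e he
  have hθ := theta_pos hk
  have hθ1 := theta_lt_one hk
  have hθm := theta_mul hk
  have hθk := theta_div hk
  have hθs := theta_sq_le hk
  have hθl := theta_le_sub_one hk
  set c := cov w (σ.insert A).M with hc
  have hc0 : ∀ v, 0 ≤ c v := cov_nonneg hM'w
  have hloan := h.loan_le hM'
  by_cases hcov : ∃ f ∈ A, ∃ v ∈ s(y₁, y₂), v ∈ f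
  · have h1 := weight_le_of_covered hk wf (fun e he => hEd e (wf.mem e he)) hMw hAw hne hyM hA
      hmax hcov
    -- The loan is at most (θ/k) `c v`, and k - θ/k ≥ 1.
    have h2 : ∀ v, cov w A v ≤ k * c v - P v := by
      intro v
      have h3 : c v = cov w (σ.M \ touching σ.M A) v + cov w A v :=
        cov_union (disjoint_sdiff_touching hA.2.1) v
      have h4 : 0 ≤ cov w (σ.M \ touching σ.M A) v :=
        cov_nonneg (fun e he => hMw e (Finset.mem_sdiff.1 he).1) v
      have h5 := hloan v
      rw [hθk] at h5
      nlinarith [hc0 v]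
    exact ⟨0, 0, Or.inl le_rfl, Or.inl le_rfl, by linarith [h2 y₁, h2 y₂]⟩
  have hbound := fun {N} hN Q hQ => weight_le_sum_cov_insert (N := N) hk wf.nonadj hMw hAw hA
    hmax hN Q hQ
  have hN := isAugmenting_singleton hyM
  have base : w s(y₁, y₂) ≤ k * (c y₁ + c y₂) := by
    have := hbound hN {y₁, y₂} (by
      intro e he v hv
      rw [Finset.mem_singleton.1 he] at hv
      exact Or.inl (by simpa using hv))
    simpa [weight, Finset.sum_pair hne] using this
  have hsub : ∀ v ∈ s(y₁, y₂), v ∈ ({y₁, y₂} : Finset V) := fun v hv => by simpa using hv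
  have hzy : ∀ z ∈ X, z ∉ s(y₁, y₂) := fun z hz hzy => by
    rcases Sym2.mem_iff.1 hzy with rfl | rfl
    · exact hy₁ hz
    · exact hy₂ hz
  have pledged : ∀ v ∈ s(y₁, y₂), ∀ z, B v z → ∃ g, s(g, v) ∈ σ.M \ touching σ.M A ∧
      g ∉ s(y₁, y₂) ∧ P v ≤ theta k * w s(g, z) ∧ s(g, z) ∈ σ.tagged s(y₁, y₂) ∧
      s(g, z) ∉ σ.M ∧ z ∈ X := by
    intro v hv z hz
    have hvA : ∀ e ∈ A, v ∉ e := fun e he hve => hcov ⟨e, he, v, hv, hve⟩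
    obtain ⟨g, hgS, ht, hzM, hgv, hzX, hP⟩ := h.pledge_insert wf hEd hv hvA hz
    refine ⟨g, hgS, fun hgy => hyM ?_, hP, ht, hzM, hzX⟩
    rw [(Sym2.mem_and_mem_iff hgv).1 ⟨hgy, hv⟩]
    exact (Finset.mem_sdiff.1 hgS).1
  -- Adding the shadow-edge gz costs nothing extra at g: the edge of `M` there is gv, already
  -- counted at v.
  have pair : ∀ v ∈ s(y₁, y₂), ∀ g z, s(g, v) ∈ σ.M \ touching σ.M A → g ∉ s(y₁, y₂) →
      s(g, z) ∈ σ.tagged s(y₁, y₂) → s(g, z) ∉ σ.M → z ∈ X → ∀ Q : Finset V, {y₁, y₂} ⊆ Q →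
      (z ∈ Q ∨ ∃ u ∈ Q, s(z, u) ∈ σ.M \ touching σ.M A) →
      w s(g, z) + w s(y₁, y₂) ≤ k * ∑ v ∈ Q, c v := by
    intro v hv g z hgS hg ht hzM hz Q hyQ hzQ
    have h1 := hbound (isAugmenting_insert hN ht hzM (by simpa using hg)
      (by simpa using hzy z hz)) Q (by
        intro e he u hu
        rcases Finset.mem_insert.1 he with rfl | he
        · rcases Sym2.mem_iff.1 hu with rfl | rfl
          · exact Or.inr ⟨v, hyQ (hsub v hv), hgS⟩
          · exact hzQ
        · rw [Finset.mem_singleton.1 he] at hu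
          exact Or.inl (hyQ (hsub u hu)))
    rwa [weight, Finset.sum_insert, Finset.sum_singleton] at h1
    rw [Finset.mem_singleton]
    intro heq
    exact hg (heq ▸ Sym2.mem_mk_left g z)
  have hsum₃ : ∀ z ∈ X, ∑ v ∈ ({y₁, y₂, z} : Finset V), c v = c y₁ + c y₂ + c z := by
    intro z hz
    have hz' := hzy z hz
    rw [Sym2.mem_iff] at hz'
    push Not at hz'
    rw [Finset.sum_insert (by simp [hne, hz'.1.symm]), Finset.sum_pair hz'.2.symm]
    ring
  -- Combine the bound from `pair` with weight θ and `base` with weight 1-θ. The vertex z then has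
  -- coefficient θk = k - 1 ≤ k - θ/k.
  have single : ∀ v ∈ s(y₁, y₂), ∀ z, B v z →
      w s(y₁, y₂) + P v ≤ k * (c y₁ + c y₂) + (k - theta k / k) * c z := by
    intro v hv z hz
    obtain ⟨g, hgS, hg, hP, ht, hzM, hzX⟩ := pledged v hv z hz
    have h1 := pair v hv g z hgS hg ht hzM hzX {y₁, y₂, z} (by intro; simp; tauto) (Or.inl (by simp))
    rw [hsum₃ z hzX] at h1
    have := hc0 z
    rw [hθk]
    nlinarith
  -- the vertex pledged against is matched to the other endpoint
  have linked : ∀ v ∈ s(y₁, y₂), ∀ u ∈ s(y₁, y₂), ∀ z, B v z →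
      s(z, u) ∈ σ.M \ touching σ.M A →
      w s(y₁, y₂) + P v + P u ≤ k * (c y₁ + c y₂) + (k - theta k / k) * c z := by
    intro v hv u hu z hz hzu
    obtain ⟨g, hgS, hg, hP, ht, hzM, hzX⟩ := pledged v hv z hz
    have h1 := pair v hv g z hgS hg ht hzM hzX {y₁, y₂} subset_rfl (Or.inr ⟨u, hsub u hu, hzu⟩)
    rw [Finset.sum_pair hne] at h1
    have hzu' : s(z, u) ∈ (σ.insert A).M := Finset.mem_union_left _ hzu
    have h2 : c z = c u := by
      rw [hc, cov_eq hM' hzu' (Sym2.mem_mk_left _ _), cov_eq hM' hzu' (Sym2.mem_mk_right _ _)]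
    have h3 := hloan u
    rw [← hc, ← h2] at h3
    rw [hθk] at h3 ⊢
    nlinarith [hc0 z]
  by_cases hB₁ : ∃ z, B y₁ z
  · obtain ⟨z₁, hz₁⟩ := hB₁
    have s₁ := single y₁ (Sym2.mem_mk_left _ _) z₁ hz₁
    by_cases hB₂ : ∃ z, B y₂ z
    · obtain ⟨z₂, hz₂⟩ := hB₂
      refine ⟨(k - theta k / k) * c z₁, (k - theta k / k) * c z₂, Or.inr ⟨z₁, hz₁, le_rfl⟩,
        Or.inr ⟨z₂, hz₂, le_rfl⟩, ?_⟩
      have hy₁m : y₁ ∈ s(y₁, y₂) := Sym2.mem_mk_left _ _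
      have hy₂m : y₂ ∈ s(y₁, y₂) := Sym2.mem_mk_right _ _
      obtain ⟨g₁, hS₁, hg₁, hP₁, ht₁, hM₁, hX₁⟩ := pledged y₁ hy₁m z₁ hz₁
      obtain ⟨g₂, hS₂, hg₂, hP₂, ht₂, hM₂, hX₂⟩ := pledged y₂ hy₂m z₂ hz₂
      have hcz₁ := hc0 z₁
      have hcz₂ := hc0 z₂
      have hcoef : 0 ≤ k - theta k / k := by
        rw [hθk]
        nlinarith
      -- Here the two shadow-edges collide and cannot be taken together. But z₁ is then matched to
      -- y₂, so the comparison with one shadow-edge needs no cost at z₁, and what z₁ releases repays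
      -- the loan of y₂.
      by_cases hzg₁ : z₁ = g₂
      · have h1 := linked y₁ hy₁m y₂ hy₂m z₁ hz₁ (hzg₁ ▸ hS₂)
        nlinarith
      by_cases hzg₂ : z₂ = g₁
      · have h1 := linked y₂ hy₂m y₁ hy₁m z₂ hz₂ (hzg₂ ▸ hS₁)
        nlinarith
      have hz : z₁ ≠ z₂ := fun hz => hne (h.inj _ _ _ hz₁ (hz ▸ hz₂))
      have hg : g₁ ≠ g₂ := by
        rintro rfl
        exact hne (wf.nonadj.right_unique (Finset.mem_sdiff.1 hS₁).1 (Finset.mem_sdiff.1 hS₂).1)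
      have hN₁ := isAugmenting_insert hN ht₁ hM₁ (by simpa using hg₁) (by simpa using hzy z₁ hX₁)
      have hg₂' : ∀ f ∈ ({s(g₁, z₁), s(y₁, y₂)} : Finset (Sym2 V)), g₂ ∉ f := by
        simpa [hg.symm, Ne.symm hzg₁] using hg₂
      have hz₂' : ∀ f ∈ ({s(g₁, z₁), s(y₁, y₂)} : Finset (Sym2 V)), z₂ ∉ f := by
        simpa [hz.symm, hzg₂] using hzy z₂ hX₂
      -- Without collisions the input edge and both shadow-edges form one augmenting set; this
      -- bound, weighted by θ, is combined with `base` below.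
      have h1 := hbound (isAugmenting_insert hN₁ ht₂ hM₂ hg₂' hz₂') {z₂, y₁, y₂, z₁} (by
        intro e he u hu
        simp only [Finset.mem_insert, Finset.mem_singleton] at he
        rcases he with rfl | rfl | rfl <;> rcases Sym2.mem_iff.1 hu with rfl | rfl
        · exact Or.inr ⟨y₂, by simp, hS₂⟩
        · exact Or.inl (by simp)
        · exact Or.inr ⟨y₁, by simp, hS₁⟩
        · exact Or.inl (by simp)
        · exact Or.inl (by simp)
        · exact Or.inl (by simp))
      have hmem : s(g₁, z₁) ∉ ({s(y₁, y₂)} : Finset (Sym2 V)) := fun hmem =>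
        hg₁ (Finset.mem_singleton.1 hmem ▸ Sym2.mem_mk_left g₁ z₁)
      have hzy₂ := hzy z₂ hX₂
      rw [Sym2.mem_iff] at hzy₂
      rw [weight, Finset.sum_insert (fun hmem => hg₂' _ hmem (Sym2.mem_mk_left _ _)),
        Finset.sum_insert hmem,
        Finset.sum_singleton, Finset.sum_insert (by simp; tauto), hsum₃ z₁ hX₁, ← hc] at h1
      have h2 := mul_le_mul_of_nonneg_left h1 hθ.le
      have h3 := mul_le_mul_of_nonneg_left base (sub_nonneg.2 hθ1.le)
      have h4 : theta k * (k * (c z₂ + (c y₁ + c y₂ + c z₁))) =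
          (k - 1) * (c z₁ + c z₂) + theta k * (k * (c y₁ + c y₂)) := by
        rw [← hθm]
        ring
      have h5 : (k - 1) * (c z₁ + c z₂) ≤ (k - theta k / k) * (c z₁ + c z₂) := by
        refine mul_le_mul_of_nonneg_right ?_ (by linarith)
        rw [hθk]
        nlinarith
      nlinarith
    · push Not at hB₂
      exact ⟨(k - theta k / k) * c z₁, 0, Or.inr ⟨z₁, hz₁, le_rfl⟩, Or.inl le_rfl,
        by linarith [h.supp y₂ hB₂]⟩
  · push Not at hB₁
    have p₁ := h.supp y₁ hB₁
    by_cases hB₂ : ∃ z, B y₂ z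
    · obtain ⟨z₂, hz₂⟩ := hB₂
      have s₂ := single y₂ (Sym2.mem_mk_right _ _) z₂ hz₂
      exact ⟨0, (k - theta k / k) * c z₂, Or.inl le_rfl, Or.inr ⟨z₂, hz₂, le_rfl⟩, by linarith⟩
    · push Not at hB₂
      exact ⟨0, 0, Or.inl le_rfl, Or.inl le_rfl, by linarith [h.supp y₂ hB₂]⟩

end Contribution

/-! ### The invariants along a run and the final bound -/

section Main

variable {V : Type*} {k : ℝ} {w : Sym2 V → ℝ}

lemma isAugmenting_empty (σ : State V) (y : Sym2 V) : σ.IsAugmenting y ∅ := by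
  simp [State.IsAugmenting, PairwiseNonadjacent]

lemma State.IsAugmenting.subset {σ : State V} {y : Sym2 V} {A C : Finset (Sym2 V)}
    (hA : σ.IsAugmenting y A) (hC : C ⊆ A) : σ.IsAugmenting y C :=
  ⟨fun e he => hA.1 e (hC he), fun e he => hA.2.1 e (hC he), hA.2.2.subset hC⟩

/-- The vertices covered by the edges of `N` that occur in `L`. -/
def readVertices (N : Finset (Sym2 V)) (L : List (Sym2 V)) : Set V :=
  {v | ∃ o ∈ N, o ∈ L ∧ v ∈ o}

/-- Every iteration inserts a maximizing set, which may be empty. -/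
lemma Step.exists_insert {E : Set (Sym2 V)} {σ τ : State V} {y : Sym2 V} (h : Step k w σ y τ)
    (wf : WellFormed E σ) : ∃ A, σ.IsAugmenting y A ∧
      (∀ C, σ.IsAugmenting y C → σ.gain k w C ≤ σ.gain k w A) ∧ τ = σ.insert A := by
  obtain ⟨A, hA, hmax, rfl⟩ := h
  split_ifs with hpos
  · exact ⟨A, hA, hmax, rfl⟩
  · refine ⟨∅, isAugmenting_empty σ y, fun C hC => (hmax C hC).trans ?_, wf.insert_empty.symm⟩
    have : σ.gain k w ∅ = 0 := by simp [State.gain, weight, touching]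
    rw [this]
    exact not_lt.1 hpos

variable [Fintype V]

lemma exists_step (σ : State V) (y : Sym2 V) : ∃ τ, Step k w σ y τ := by
  obtain ⟨A, hA, hmax⟩ := Finset.exists_max_image
    (Finset.univ.filter fun A => σ.IsAugmenting y A) (σ.gain k w)
    ⟨∅, by simpa using isAugmenting_empty σ y⟩
  simp only [Finset.mem_filter, Finset.mem_univ, true_and] at hA hmax
  exact ⟨_, A, hA, hmax, rfl⟩

lemma exists_run (L : List (Sym2 V)) : ∃ σ, Run k w L σ := by
  induction L using List.reverseRecOn with
  | nil => exact ⟨_, Run.nil⟩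
  | append_singleton L y ih =>
    obtain ⟨σ, hσ⟩ := ih
    obtain ⟨τ, hτ⟩ := exists_step σ y
    exact ⟨τ, hσ.snoc hτ⟩

/-- Each iteration is accounted for as an insertion with the old `X`, followed by the reading of the
input edge if it lies in `N`. The insertion comes first because `Ledger.contribution` measures the
input edge against the matching after it. -/
theorem Run.exists_ledger (hk : 1 < k) {N : Finset (Sym2 V)} (hN : PairwiseNonadjacent N)
    {L : List (Sym2 V)} {σ : State V} (h : Run k w L σ) (hL : L.Nodup)
    (hLd : ∀ e ∈ L, ¬ e.IsDiag) (hLw : ∀ e ∈ L, 0 ≤ w e) :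
    WellFormed {e | e ∈ L} σ ∧ ∃ d B P,
      Ledger k w σ (readVertices N L) (weight w (N.filter (· ∈ L))) d B P := by
  induction h with
  | nil =>
    refine ⟨⟨by simp [State.init], by simp [State.init, PairwiseNonadjacent],
      by simp [State.init]⟩, 0, fun _ _ => False, fun _ => 0, ?_⟩
    refine ⟨by simp, by simp, by simp, by simp, by simp [State.init], ?_,
      by simp [State.init, weight]⟩
    simp [weight, value, cov, State.init]
  | @snoc L σ τ y hrun hstep ih =>
    have hmem : ∀ e, e ∈ L ++ [y] ↔ e = y ∨ e ∈ L := fun e => by simp [or_comm]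
    have hyL : y ∉ L := by
      intro hy
      exact (List.nodup_append.1 hL).2.2 y hy y (by simp) rfl
    obtain ⟨wf, d, B, P, hled⟩ := ih (List.nodup_append.1 hL).1
      (fun e he => hLd e ((hmem e).2 (Or.inr he))) (fun e he => hLw e ((hmem e).2 (Or.inr he)))
    obtain ⟨A, hA, hmax, rfl⟩ := hstep.exists_insert wf
    have hE : {e | e ∈ L ++ [y]} = insert y {e | e ∈ L} := by
      ext e
      simp [hmem]
    have wf' := wf.insert hA
    rw [← hE] at wf'
    have hA' : ∀ e ∈ A, e ∈ L ++ [y] := fun e he => wf'.mem e (Finset.mem_union_right _ he)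
    have hM' : ∀ e ∈ σ.M, e ∈ L ++ [y] := fun e he => (hmem e).2 (Or.inr (wf.mem e he))
    have hMw : ∀ e ∈ σ.M, 0 ≤ w e := fun e he => hLw e (hM' e he)
    have hAw : ∀ e ∈ A, 0 ≤ w e := fun e he => hLw e (hA' e he)
    obtain ⟨B₁, P₁, hled₁⟩ := hled.insert hk wf.nonadj (fun e he => hLd e (hM' e he)) hMw
      hA.2.2 hA.2.1 (fun e he => hLd e (hA' e he)) hAw fun C hC => hmax C (hA.subset hC)
    refine ⟨wf', d + weight w (touching σ.M A), ?_⟩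
    by_cases hyN : y ∈ N
    · have hyM : y ∉ σ.M := fun hy => hyL (wf.mem y hy)
      have hyX : ∀ v ∈ y, v ∉ readVertices N L := by
        rintro v hv ⟨o, hoN, hoL, hvo⟩
        exact hyL (hN.eq_of_mem hyN hoN hv hvo ▸ hoL)
      have hyd : ¬ y.IsDiag := hLd y ((hmem y).2 (Or.inl rfl))
      induction y with
      | h y₁ y₂ =>
        have hne : y₁ ≠ y₂ := by simpa using hyd
        have hy₁ := hyX y₁ (Sym2.mem_mk_left _ _)
        have hy₂ := hyX y₂ (Sym2.mem_mk_right _ _)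
        obtain ⟨ζ₁, ζ₂, hζ₁, hζ₂, hle⟩ := hled₁.contribution hk wf
          (fun e he => hLd e ((hmem e).2 (Or.inr he))) hMw hAw hne hyM hA hmax hy₁ hy₂
        obtain ⟨B₂, P₂, hled₂⟩ := hled₁.read hk (fun e he => hLw e (wf'.mem e he)) hne hy₁ hy₂
          hζ₁ hζ₂ hle
        refine ⟨B₂, P₂, ?_⟩
        have hX : readVertices N (L ++ [s(y₁, y₂)]) = readVertices N L ∪ {y₁, y₂} := by
          ext v
          simp only [readVertices, hmem, Set.mem_ofPred_eq, Set.mem_union, Set.mem_insert_iff,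
            Set.mem_singleton_iff]
          constructor
          · rintro ⟨o, hoN, rfl | hoL, hvo⟩
            · exact Or.inr (Sym2.mem_iff.1 hvo)
            · exact Or.inl ⟨o, hoN, hoL, hvo⟩
          · rintro (⟨o, hoN, hoL, hvo⟩ | hv)
            · exact ⟨o, hoN, Or.inr hoL, hvo⟩
            · exact ⟨_, hyN, Or.inl rfl, Sym2.mem_iff.2 hv⟩
        have hO : N.filter (· ∈ L ++ [s(y₁, y₂)]) =
            insert s(y₁, y₂) (N.filter (· ∈ L)) := by
          ext e
          simp only [Finset.mem_filter, hmem, Finset.mem_insert]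
          constructor
          · rintro ⟨h1, h2 | h2⟩
            · exact Or.inl h2
            · exact Or.inr ⟨h1, h2⟩
          · rintro (rfl | ⟨h1, h2⟩)
            · exact ⟨hyN, Or.inl rfl⟩
            · exact ⟨h1, Or.inr h2⟩
        rw [hX, hO, weight, Finset.sum_insert (by simp [hyL]), add_comm]
        exact hled₂
    · have hX : readVertices N (L ++ [y]) = readVertices N L := by
        ext v
        simp only [readVertices, hmem, Set.mem_ofPred_eq]
        constructor
        · rintro ⟨o, hoN, rfl | hoL, hvo⟩
          · exact absurd hoN hyN
          · exact ⟨o, hoN, hoL, hvo⟩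
        · rintro ⟨o, hoN, hoL, hvo⟩
          exact ⟨o, hoN, Or.inr hoL, hvo⟩
      have hO : N.filter (· ∈ L ++ [y]) = N.filter (· ∈ L) := by
        refine Finset.filter_congr fun e he => ?_
        rw [hmem]
        constructor
        · rintro (rfl | h)
          · exact absurd he hyN
          · exact h
        · exact Or.inr
      rw [hX, hO]
      exact ⟨B₁, P₁, hled₁⟩

lemma ratio_eq (hk : 1 < k) : ratio k = 2 * k + (k - theta k ^ 2) / (k - 1) := by
  have h1 : k ≠ 0 := by linarith
  have h2 : k - 1 ≠ 0 := by linarith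
  rw [ratio, theta]
  field_simp
  ring

/-- Pledged vertices and loans also count for at most k times the covering weight, since θ/k ≤ k.
The values therefore total at most 2k w(M), and `dead` bounds the charge for removed edges. -/
lemma Ledger.bound (hk : 1 < k) {σ : State V} {X : Set V} {O d : ℝ} {B : V → V → Prop}
    {P : V → ℝ} (h : Ledger k w σ X O d B P) (hM : PairwiseNonadjacent σ.M)
    (hMd : ∀ e ∈ σ.M, ¬ e.IsDiag) (hMw : ∀ e ∈ σ.M, 0 ≤ w e) :
    O ≤ ratio k * weight w σ.M := by
  have hθ := theta_pos hk
  have hθk := theta_div hk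
  have hθs := theta_sq_le hk
  have hθl := theta_le_sub_one hk
  have hle : theta k / k ≤ k := by
    rw [hθk]
    nlinarith
  have h1 : ∑ v, value k w σ.M X B P v ≤ ∑ v, k * cov w σ.M v := by
    refine Finset.sum_le_sum fun v _ => ?_
    have hc := cov_nonneg hMw v
    rw [value]
    split_ifs
    · exact mul_le_mul_of_nonneg_right hle hc
    · exact le_rfl
    · exact (h.loan_le hM v).trans (mul_le_mul_of_nonneg_right hle hc)
  rw [← Finset.mul_sum, sum_cov hM hMd] at h1
  have h2 : d ≤ weight w σ.M / (k - 1) := by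
    rw [le_div_iff₀ (by linarith)]
    linarith [h.dead]
  have h3 := mul_le_mul_of_nonneg_left h2 (show 0 ≤ k - theta k ^ 2 by nlinarith)
  have h4 : ratio k * weight w σ.M =
      k * (2 * weight w σ.M) + (k - theta k ^ 2) * (weight w σ.M / (k - 1)) := by
    rw [ratio_eq hk]
    ring
  linarith [h.energy]

/-- The output is a matching, and every matching weighs at most `ratio k` times as much. -/
theorem Run.isMatching_and_weight_le (hk : 1 < k) {G : SimpleGraph V}
    (hw : ∀ e ∈ G.edgeSet, 0 < w e) {L : List (Sym2 V)} (hL : IsEdgeStream G L) {σ : State V}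
    (h : Run k w L σ) :
    IsMatching G σ.M ∧ ∀ N, IsMatching G N → weight w N ≤ ratio k * weight w σ.M := by
  have hLd : ∀ e ∈ L, ¬ e.IsDiag := fun e he => G.not_isDiag_of_mem_edgeSet ((hL.2 e).1 he)
  have hLw : ∀ e ∈ L, 0 ≤ w e := fun e he => (hw e ((hL.2 e).1 he)).le
  have hledger := fun {N} (hN : PairwiseNonadjacent N) => h.exists_ledger hk hN hL.1 hLd hLw
  have wf := (hledger (N := ∅) (by simp [PairwiseNonadjacent])).1
  refine ⟨⟨fun e he => (hL.2 e).1 (wf.mem e he), wf.nonadj⟩, fun N hN => ?_⟩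
  obtain ⟨-, d, B, P, hled⟩ := hledger hN.2
  rw [Finset.filter_true_of_mem fun e he => (hL.2 e).2 (hN.1 e he)] at hled
  exact hled.bound hk wf.nonadj (fun e he => hLd e (wf.mem e he)) fun e he => hLw e (wf.mem e he)

end Main

/-! ### Minimizing the factor -/

section Ratio

lemma ratio_near : |ratio 1.717 - 5.585| < 0.0005 := by
  rw [ratio, abs_lt]
  constructor <;> norm_num

/-- The hypothesis says that the derivative of `ratio` vanishes at `k₀`. The excess of `ratio` over
its tangent there is a square times a nonnegative factor, an explicit form of convexity. -/
lemma ratio_le_of_critical {k₀ k : ℝ} (hk₀ : 1 < k₀) (hk : 1 < k)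
    (h : 2 - 1 / (k₀ - 1) ^ 2 + 1 / k₀ ^ 2 - 2 / k₀ ^ 3 = 0) : ratio k₀ ≤ ratio k := by
  have h1 : 0 < k₀ - 1 := by linarith
  have h2 : 0 < k - 1 := by linarith
  have h3 : 0 < k₀ := by linarith
  have h4 : 0 < k := by linarith
  have key : ratio k - ratio k₀ -
      (2 - 1 / (k₀ - 1) ^ 2 + 1 / k₀ ^ 2 - 2 / k₀ ^ 3) * (k - k₀) =
      (k - k₀) ^ 2 * ((1 / ((k₀ - 1) ^ 2 * (k - 1)) - 1 / (k₀ ^ 2 * k)) +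
        (2 * k + k₀) / (k₀ ^ 3 * k ^ 2)) := by
    simp only [ratio]
    field_simp
    ring
  have h5 : 1 / (k₀ ^ 2 * k) ≤ 1 / ((k₀ - 1) ^ 2 * (k - 1)) := by
    refine one_div_le_one_div_of_le (by positivity) ?_
    gcongr <;> linarith
  have h6 : 0 ≤ (2 * k + k₀) / (k₀ ^ 3 * k ^ 2) := by positivity
  rw [h, zero_mul, sub_zero] at key
  have h7 := mul_nonneg (sq_nonneg (k - k₀)) (add_nonneg (sub_nonneg.2 h5) h6)
  linarith

/-- The derivative of `ratio` changes sign on this interval, which is short enough for the crude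
estimates in `lt_ratio`. -/
lemma exists_critical : ∃ k₀ : ℝ, 1.717 < k₀ ∧ k₀ < 1.7172 ∧
    2 - 1 / (k₀ - 1) ^ 2 + 1 / k₀ ^ 2 - 2 / k₀ ^ 3 = 0 := by
  have hcont : ContinuousOn (fun x : ℝ => 2 - 1 / (x - 1) ^ 2 + 1 / x ^ 2 - 2 / x ^ 3)
      (Set.Icc 1.717 1.7172) := by
    have h1 : ∀ x ∈ Set.Icc (1.717 : ℝ) 1.7172, (x - 1) ^ 2 ≠ 0 := fun x hx => by
      have : (1.717 : ℝ) ≤ x := hx.1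
      have : 0 < x - 1 := by norm_num at this ⊢; linarith
      positivity
    have h2 : ∀ x ∈ Set.Icc (1.717 : ℝ) 1.7172, 0 < x := fun x hx => by
      have : (1.717 : ℝ) ≤ x := hx.1
      norm_num at this; linarith
    refine ContinuousOn.sub (ContinuousOn.add (ContinuousOn.sub continuousOn_const ?_) ?_) ?_
    · exact ContinuousOn.div continuousOn_const (by fun_prop) h1
    · exact ContinuousOn.div continuousOn_const (by fun_prop) fun x hx => (pow_pos (h2 x hx) _).ne'
    · exact ContinuousOn.div continuousOn_const (by fun_prop) fun x hx => (pow_pos (h2 x hx) _).ne'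
  obtain ⟨k₀, hk₀, h0⟩ := intermediate_value_Ioo (by norm_num) hcont
    (show (0 : ℝ) ∈ Set.Ioo _ _ by constructor <;> norm_num)
  exact ⟨k₀, hk₀.1, hk₀.2, h0⟩

/-- After expansion into partial fractions each term is monotone and is bounded at an endpoint of
the interval. The matching upper bound at the minimizer needs no estimate: it follows from
comparison with 1.717. -/
lemma lt_ratio {k : ℝ} (h₁ : 1.717 < k) (h₂ : k < 1.7172) : 5.5845 < ratio k := by
  have h3 : 0 < k := lt_trans (by norm_num) h₁
  have h4 : 0 < k - 1 := sub_pos.2 (lt_trans (by norm_num) h₁)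
  have e : ratio k = 2 * k + 1 + 1 / (k - 1) - 1 / k + 1 / k ^ 2 := by
    rw [ratio]
    field_simp
    ring
  have a1 : 1 / (1.7172 - 1) ≤ 1 / (k - 1) := one_div_le_one_div_of_le h4 (by linarith)
  have a2 : 1 / k ≤ 1 / 1.717 := one_div_le_one_div_of_le (by norm_num) h₁.le
  have a3 : 1 / 1.7172 ^ 2 ≤ 1 / k ^ 2 :=
    one_div_le_one_div_of_le (by positivity) (pow_le_pow_left₀ h3.le h₂.le 2)
  rw [e]
  norm_num at a1 a2 a3 h₁ ⊢
  linarith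

end Ratio

end ShadowMatching

theorem theorem1 {V : Type*} [Finite V] (G : SimpleGraph V) (w : Sym2 V → ℝ)
    (hw : ∀ e ∈ G.edgeSet, 0 < w e) (L : List (Sym2 V)) (hL : ShadowMatching.IsEdgeStream G L) :
    (∀ k : ℝ, 1 < k →
      (∃ σ, ShadowMatching.Run k w L σ) ∧
      ∀ σ, ShadowMatching.Run k w L σ →
        ShadowMatching.IsMatching G σ.M ∧
        ∀ Mopt, ShadowMatching.IsMaxWeightMatching G w Mopt →
          ShadowMatching.weight w Mopt ≤
            ShadowMatching.ratio k * ShadowMatching.weight w σ.M) ∧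
    (∃ k₀ : ℝ, 1 < k₀ ∧ |k₀ - 1.717| < 0.0005 ∧
      (∀ k : ℝ, 1 < k → ShadowMatching.ratio k₀ ≤ ShadowMatching.ratio k) ∧
      |ShadowMatching.ratio k₀ - 5.585| < 0.0005) ∧
    |ShadowMatching.ratio 1.717 - 5.585| < 0.0005 ∧
    (∀ σ, ShadowMatching.Run 1.717 w L σ →
      ∀ Mopt, ShadowMatching.IsMaxWeightMatching G w Mopt →
        ShadowMatching.weight w Mopt ≤ 5.5855 * ShadowMatching.weight w σ.M) := by
  have := Fintype.ofFinite V
  have hnear := abs_lt.1 ShadowMatching.ratio_near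
  refine ⟨fun k hk => ⟨ShadowMatching.exists_run L, fun σ hσ => ?_⟩, ?_,
    ShadowMatching.ratio_near, fun σ hσ Mopt hopt => ?_⟩
  · obtain ⟨h1, h2⟩ := hσ.isMatching_and_weight_le hk hw hL
    exact ⟨h1, fun Mopt hopt => h2 Mopt hopt.1⟩
  · obtain ⟨k₀, h1, h2, h0⟩ := ShadowMatching.exists_critical
    have hk₀ : 1 < k₀ := lt_trans (by norm_num) h1
    have hmin := fun k hk => ShadowMatching.ratio_le_of_critical (k := k) hk₀ hk h0
    refine ⟨k₀, hk₀, abs_lt.2 ⟨by linarith, ?_⟩, hmin, abs_lt.2 ⟨?_, ?_⟩⟩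
    · norm_num at h2 ⊢
      linarith
    · linarith [ShadowMatching.lt_ratio h1 h2]
    · linarith [hmin 1.717 (by norm_num)]
  · obtain ⟨h1, h2⟩ := hσ.isMatching_and_weight_le (by norm_num) hw hL
    refine (h2 Mopt hopt.1).trans (mul_le_mul_of_nonneg_right (by linarith) ?_)
    exact Finset.sum_nonneg fun e he => (hw e (h1.1 e he)).le
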